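/- Let $M$ be an oriented matroid on a finite linearly ordered set $E$; every minor of $M$ is ordered by the induced order, and $\subset$ denotes strict inclusion. A circuit or cocircuit is positive if all its signs are positive; a positive circuit or cocircuit is identified with its support. Call $M$ acyclic if it has no positive circuit, and totally cyclic if every element belongs to a positive circuit. Call $M$ bounded with respect to $p\in E$ if it is acyclic and every positive cocircuit contains $p$, and dual-bounded with respect to $p\in E$ if it is totally cyclic and every positive circuit contains $p$. For $F\subseteq E$, $M(F)$ denotes the restriction of $M$ to $F$ and $M/F$ the contraction of $F$. A filtration of $M$ is a sequence $(F'_\varepsilon,\dots,F'_0,F_c,F_0,\dots,F_\iota)$ of subsets of $E$, with $\iota,\varepsilon\ge 0$, such that $$\emptyset=F'_\varepsilon\subset\dots\subset F'_0=F_c=F_0\subset\dots\subset F_\iota=E,$$ $\min(F_k\setminus F_{k-1})$ is increasing with $k$ for $1\le k\le\iota$, and $\min(F'_{k-1}\setminus F'_k)$ is increasing with $k$ for $1\le k\le\varepsilon$. It is a connected filtration if moreover, for $1\le k\le\iota$, the underlying matroid of $M(F_k)/F_{k-1}$ is connected (any two distinct elements lie in a common circuit) and is not a single loop, and, for $1\le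 k\le\varepsilon$, the underlying matroid of $M(F'_{k-1})/F'_k$ is connected and is not a single isthmus (coloop). Let $a_1<\dots<a_\iota$ be the elements of $E$ that are the smallest element of some positive cocircuit of $M$, and $a'_1<\dots<a'_\varepsilon$ those that are the smallest element of some positive circuit of $M$. The active filtration of $M$ is the sequence $(F'_\varepsilon,\dots,F'_0,F_c,F_0,\dots,F_\iota)$ where $F_c$ is the union of all positive circuits of $M$, $F_\iota=E$, $F'_\varepsilon=\emptyset$, $$F_k=E\setminus\bigcup_{\substack{D\text{ positive cocircuit}\\ \min(D)\ge a_{k+1}}}D\quad(0\le k\le\iota-1),\qquad F'_k=\bigcup_{\substack{C\text{ positive circuit}\\ \min(C)\ge a'_{k+1}}}C\quad(0\le k\le\varepsilon-1).$$ Theorem. The active filtration of $M$ is a connected filtration of $M$. It is the unique filtration $(F'_\varepsilon,\dots,F'_0,F_c,F_0,\dots,F_\iota)$ of $M$ (with $\iota$ and $\varepsilon$ not prescribed) such that the minors $M(F_k)/F_{k-1}$, $1\le k\le\iota$, are bounded with respect to $\min(F_k\setminus F_{k-1})$ and the minors $M(F'_{k-1})/F'_k$, $1\le k\le\varepsilon$,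 are dual-bounded with respect to $\min(F'_{k-1}\setminus F'_k)$. -/

import Mathlib

/-! ### Sign vectors -/

namespace SignVec

variable {α : Type*}

/-- Composition `X ∘ Y` of sign vectors. -/
def comp (X Y : α → SignType) : α → SignType :=
  fun e => if X e = 0 then Y e else X e

/-- The separation set `S(X, Y)`: elements at which `X` and `Y` have opposite nonzero signs. -/
def sep (X Y : α → SignType) : Set α :=
  {e | X e ≠ 0 ∧ X e = - Y e}

/-- Orthogonality of sign vectors: either the supports are disjoint, or the two vectors agree
at some common element of the supports and are opposite at another one. -/
def Orthogonal (X Y : α → SignType) : Prop :=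
  (∀ e, X e * Y e = 0) ∨ ((∃ e, X e * Y e = 1) ∧ (∃ e, X e * Y e = -1))

/-- `X` is a nonzero member of `S` whose support is inclusion-minimal among the supports of
nonzero members of `S`. -/
def IsMinSupport (S : Set (α → SignType)) (X : α → SignType) : Prop :=
  X ∈ S ∧ X ≠ 0 ∧
    ∀ Y ∈ S, Y ≠ 0 → Function.support Y ⊆ Function.support X →
      Function.support Y = Function.support X

end SignVec

/-- An oriented matroid on a finite ground set `E ⊆ α`, given by its covectors.
A sign vector on `E` is encoded as a function `α → SignType` that vanishes outside `E`. -/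
structure OrientedMatroid (α : Type*) where
  /-- ground set -/
  E : Set α
  finite_ground : E.Finite
  /-- covectors -/
  covectors : Set (α → SignType)
  support_subset : ∀ X ∈ covectors, Function.support X ⊆ E
  zero_mem : (0 : α → SignType) ∈ covectors
  neg_mem : ∀ X ∈ covectors, -X ∈ covectors
  comp_mem : ∀ X ∈ covectors, ∀ Y ∈ covectors, SignVec.comp X Y ∈ covectors
  elimination : ∀ X ∈ covectors, ∀ Y ∈ covectors, ∀ e ∈ SignVec.sep X Y,
    ∃ Z ∈ covectors, Z e = 0 ∧ ∀ f ∉ SignVec.sep X Y, Z f = SignVec.comp X Y f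

namespace OrientedMatroid

variable {α : Type*}

/-- The vectors: sign vectors on the ground set orthogonal to all covectors. -/
def vectors (M : OrientedMatroid α) : Set (α → SignType) :=
  {V | Function.support V ⊆ M.E ∧ ∀ X ∈ M.covectors, SignVec.Orthogonal V X}

/-- Signed circuits: nonzero vectors of minimal support. -/
def IsCircuit (M : OrientedMatroid α) (C : α → SignType) : Prop :=
  SignVec.IsMinSupport M.vectors C

/-- Signed cocircuits: nonzero covectors of minimal support. -/
def IsCocircuit (M : OrientedMatroid α) (D : α → SignType) : Prop :=
  SignVec.IsMinSupport M.covectors D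

/-- The set `C` is (the support of) a positive circuit: a signed circuit all of whose signs
are `+`. -/
def IsPosCircuit (M : OrientedMatroid α) (C : Set α) : Prop :=
  ∃ X, M.IsCircuit X ∧ (∀ e, 0 ≤ X e) ∧ Function.support X = C

/-- The set `D` is (the support of) a positive cocircuit. -/
def IsPosCocircuit (M : OrientedMatroid α) (D : Set α) : Prop :=
  ∃ X, M.IsCocircuit X ∧ (∀ e, 0 ≤ X e) ∧ Function.support X = D

/-! ### Minors -/

/-- The restriction `M(F)`: its covectors are the restrictions to `F` of the covectors. -/
noncomputable def restrict (M : OrientedMatroid α) (F : Set α) : OrientedMatroid α where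
  E := M.E ∩ F
  finite_ground := M.finite_ground.subset Set.inter_subset_left
  covectors := (fun X => F.indicator X) '' M.covectors
  support_subset := by
    rintro _ ⟨X, hX, rfl⟩ e he
    rw [Function.mem_support, Set.indicator_apply_ne_zero] at he
    exact ⟨M.support_subset X hX he.2, he.1⟩
  zero_mem := ⟨0, M.zero_mem, by simp⟩
  neg_mem := by
    rintro _ ⟨X, hX, rfl⟩
    refine ⟨-X, M.neg_mem X hX, ?_⟩
    funext e
    by_cases he : e ∈ F <;> simp [he]
  comp_mem := by
    rintro _ ⟨X, hX, rfl⟩ _ ⟨Y, hY, rfl⟩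
    refine ⟨_, M.comp_mem X hX Y hY, ?_⟩
    funext e
    by_cases he : e ∈ F <;> simp [he, SignVec.comp]
  elimination := by
    rintro _ ⟨X, hX, rfl⟩ _ ⟨Y, hY, rfl⟩ e ⟨he0, he⟩
    have heF : e ∈ F := (Set.indicator_apply_ne_zero.1 he0).1
    simp only [Set.indicator_of_mem heF] at he0 he
    obtain ⟨Z, hZ, hZe, hZf⟩ := M.elimination X hX Y hY e ⟨he0, he⟩
    refine ⟨_, ⟨Z, hZ, rfl⟩, by simp [hZe], fun f hf => ?_⟩
    by_cases hfF : f ∈ F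
    · have : f ∉ SignVec.sep X Y := by simpa [SignVec.sep, hfF] using hf
      simpa [hfF, SignVec.comp] using hZf f this
    · simp [hfF, SignVec.comp]

/-- The contraction `M / A`: its covectors are the covectors that vanish on `A`. -/
def contract (M : OrientedMatroid α) (A : Set α) : OrientedMatroid α where
  E := M.E \ A
  finite_ground := M.finite_ground.subset Set.sdiff_subset
  covectors := {X | X ∈ M.covectors ∧ ∀ e ∈ A, X e = 0}
  support_subset := fun X hX e he => ⟨M.support_subset X hX.1 he, fun hA => he (hX.2 e hA)⟩
  zero_mem := ⟨M.zero_mem, fun _ _ => rfl⟩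
  neg_mem := fun X hX => ⟨M.neg_mem X hX.1, fun e he => by simp [hX.2 e he]⟩
  comp_mem := fun X hX Y hY =>
    ⟨M.comp_mem X hX.1 Y hY.1, fun e he => by simp [SignVec.comp, hX.2 e he, hY.2 e he]⟩
  elimination := by
    rintro X ⟨hX, hXA⟩ Y ⟨hY, hYA⟩ e he
    obtain ⟨Z, hZ, hZe, hZf⟩ := M.elimination X hX Y hY e he
    refine ⟨Z, ⟨hZ, fun f hf => ?_⟩, hZe, hZf⟩
    rw [hZf f (fun h => h.1 (hXA f hf))]
    simp [SignVec.comp, hXA f hf, hYA f hf]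

/-! ### Properties of the underlying matroid -/

/-- The underlying matroid is connected: any two distinct elements lie in a common circuit. -/
def Connected (M : OrientedMatroid α) : Prop :=
  ∀ e ∈ M.E, ∀ f ∈ M.E, e ≠ f → ∃ C, M.IsCircuit C ∧ C e ≠ 0 ∧ C f ≠ 0

/-- The underlying matroid is a loop: it has a unique element, and this element is a loop. -/
def IsLoop (M : OrientedMatroid α) : Prop :=
  ∃ e, M.E = {e} ∧ ∃ C, M.IsCircuit C ∧ Function.support C = {e}

/-- The underlying matroid is an isthmus: it has a unique element, and this element is an
isthmus (coloop). -/
def IsIsthmus (M : OrientedMatroid α) : Prop :=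
  ∃ e, M.E = {e} ∧ ∃ D, M.IsCocircuit D ∧ Function.support D = {e}

/-! ### Acyclic, totally cyclic, bounded and dual-bounded oriented matroids -/

/-- There is no positive circuit. -/
def Acyclic (M : OrientedMatroid α) : Prop :=
  ∀ C, ¬ M.IsPosCircuit C

/-- Every element belongs to a positive circuit. -/
def TotallyCyclic (M : OrientedMatroid α) : Prop :=
  ∀ e ∈ M.E, ∃ C, M.IsPosCircuit C ∧ e ∈ C

/-- `M` is bounded with respect to the element `p`. -/
def Bounded (M : OrientedMatroid α) (p : α) : Prop :=
  p ∈ M.E ∧ M.Acyclic ∧ ∀ D, M.IsPosCocircuit D → p ∈ D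

/-- `M` is dual-bounded with respect to the element `p`. -/
def DualBounded (M : OrientedMatroid α) (p : α) : Prop :=
  p ∈ M.E ∧ M.TotallyCyclic ∧ ∀ C, M.IsPosCircuit C → p ∈ C

end OrientedMatroid

/-! ### Filtrations -/

/-- A sequence of sets `(F'_ε, …, F'_0, F_c, F_0, …, F_ι)`. -/
@[ext]
structure FiltrationSeq (α : Type*) where
  ι : ℕ
  ε : ℕ
  F : Fin (ι + 1) → Set α
  Fc : Set α
  F' : Fin (ε + 1) → Set α

/-- The sequence `S` is a filtration of the set `E`: one has
`∅ = F'_ε ⊂ ⋯ ⊂ F'_0 = F_c = F_0 ⊂ ⋯ ⊂ F_ι = E` with strict inclusions, and the sequences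
`min (F_k \ F_{k-1})`, `1 ≤ k ≤ ι`, and `min (F'_{k-1} \ F'_k)`, `1 ≤ k ≤ ε`, are increasing
with `k`. An index `k : Fin ι` of the code stands for `k + 1` in these formulas. -/
structure FiltrationSeq.IsFiltration {α : Type*} [LinearOrder α]
    (S : FiltrationSeq α) (E : Set α) : Prop where
  bot : S.F' (Fin.last S.ε) = ∅
  strictAnti : StrictAnti S.F'
  F'_zero : S.F' 0 = S.Fc
  F_zero : S.F 0 = S.Fc
  strictMono : StrictMono S.F
  top : S.F (Fin.last S.ι) = E
  min_F : ∃ a : Fin S.ι → α, StrictMono a ∧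
    ∀ k, IsLeast (S.F k.succ \ S.F k.castSucc) (a k)
  min_F' : ∃ a' : Fin S.ε → α, StrictMono a' ∧
    ∀ k, IsLeast (S.F' k.castSucc \ S.F' k.succ) (a' k)

namespace OrientedMatroid

variable {α : Type*}

/-- `S` is a connected filtration of (the matroid underlying) `M`. -/
structure IsConnectedFiltration [LinearOrder α] (M : OrientedMatroid α)
    (S : FiltrationSeq α) : Prop where
  isFiltration : S.IsFiltration M.E
  connected_F : ∀ k : Fin S.ι,
    ((M.restrict (S.F k.succ)).contract (S.F k.castSucc)).Connected ∧
      ¬ ((M.restrict (S.F k.succ)).contract (S.F k.castSucc)).IsLoop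
  connected_F' : ∀ k : Fin S.ε,
    ((M.restrict (S.F' k.castSucc)).contract (S.F' k.succ)).Connected ∧
      ¬ ((M.restrict (S.F' k.castSucc)).contract (S.F' k.succ)).IsIsthmus

/-- The minors `M(F_k)/F_{k-1}` are bounded with respect to `min (F_k \ F_{k-1})`, and the
minors `M(F'_{k-1})/F'_k` are dual-bounded with respect to `min (F'_{k-1} \ F'_k)`. -/
structure HasBoundedMinors [LinearOrder α] (M : OrientedMatroid α)
    (S : FiltrationSeq α) : Prop where
  bounded : ∀ k : Fin S.ι, ∃ a, IsLeast (S.F k.succ \ S.F k.castSucc) a ∧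
    ((M.restrict (S.F k.succ)).contract (S.F k.castSucc)).Bounded a
  dualBounded : ∀ k : Fin S.ε, ∃ a', IsLeast (S.F' k.castSucc \ S.F' k.succ) a' ∧
    ((M.restrict (S.F' k.castSucc)).contract (S.F' k.succ)).DualBounded a'

/-! ### The active filtration -/

/-- `O*(M)`: the dual-active elements, smallest elements of positive cocircuits. -/
def dualActive [LinearOrder α] (M : OrientedMatroid α) : Set α :=
  {a | ∃ D, M.IsPosCocircuit D ∧ IsLeast D a}

/-- `O(M)`: the active elements, smallest elements of positive circuits. -/
def active [LinearOrder α] (M : OrientedMatroid α) : Set α :=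
  {a | ∃ C, M.IsPosCircuit C ∧ IsLeast C a}

theorem dualActive_finite [LinearOrder α] (M : OrientedMatroid α) : M.dualActive.Finite := by
  refine M.finite_ground.subset ?_
  rintro a ⟨_, ⟨X, hX, -, rfl⟩, ha⟩
  exact M.support_subset X hX.1 ha.1

theorem active_finite [LinearOrder α] (M : OrientedMatroid α) : M.active.Finite := by
  refine M.finite_ground.subset ?_
  rintro a ⟨_, ⟨X, hX, -, rfl⟩, ha⟩
  exact hX.1.1 ha.1

/-- The active filtration. With the dual-active elements `a_1 < ⋯ < a_ι` and the active elements
`a'_1 < ⋯ < a'_ε`, for `0 ≤ k < ι` the set `F_k` is the complement of the union of the positive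
cocircuits with smallest element `≥ a_{k+1}`, and for `0 ≤ k < ε` the set `F'_k` is the union of
the positive circuits with smallest element `≥ a'_{k+1}`; moreover `F_ι = E`, `F'_ε = ∅`, and
`F_c` is the union of all positive circuits. The enumerations `orderEmbOfFin` start at index `0`,
so that `a_{k+1}` is the value at `k`. -/
noncomputable def activeFiltration [LinearOrder α] (M : OrientedMatroid α) :
    FiltrationSeq α where
  ι := M.dualActive_finite.toFinset.card
  ε := M.active_finite.toFinset.card
  F := Fin.snoc (α := fun _ => Set α)
    (fun k => M.E \ ⋃₀ {D | M.IsPosCocircuit D ∧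
      ∃ m, IsLeast D m ∧ M.dualActive_finite.toFinset.orderEmbOfFin rfl k ≤ m})
    M.E
  Fc := ⋃₀ {C | M.IsPosCircuit C}
  F' := Fin.snoc (α := fun _ => Set α)
    (fun k => ⋃₀ {C | M.IsPosCircuit C ∧
      ∃ m, IsLeast C m ∧ M.active_finite.toFinset.orderEmbOfFin rfl k ≤ m})
    ∅

end OrientedMatroid

/-! ### Orthogonality and composition of sign vectors -/

namespace SignVec

variable {α : Type*}

/-! The engine is the painting lemma (a Farkas lemma for oriented matroids). It shows that the
vectors form a dual oriented matroid with bidual `M`, and that every element lies in a positive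
circuit or in a positive cocircuit, never in both. Duality exchanges M(G)/F with M*(E \ F)/(E \ G)
and dual-bounded with bounded. So only the upper half F_0 ⊂ ⋯ ⊂ E needs study: the lower half is the
complement of the upper half for the dual.

Existence: E \ F_k is a union of positive cocircuits, hence the support of a nonnegative covector
T_k. Restricted to F_k, T_{k-1} shows that the k-th minor is acyclic. A positive cocircuit X of this
minor lifts to the nonnegative covector T_k ∘ X. A positive cocircuit of `M` below T_k ∘ X that
meets F_k has smallest element a_k, which therefore lies in X.

Uniqueness: for any chain with bounded minors, composing positive covectors of the minors from the
top shows that E \ F_k is a union of positive cocircuits. Conversely, if D is a positive cocircuit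
disjoint from F_0, consider a step at which D begins to meet the chain. Boundedness of that minor
puts its distinguished element in D, and since the minima increase this element is min D. So the
minima are exactly the dual-active elements, and they determine the sets F_k.

Connectedness: if some element shared no circuit with p, the part of a positive covector carried by
such elements would be a nonnegative covector avoiding p. For dual-bounded minors it suffices that
sharing a cocircuit is transitive, since in the dual every element lies in a positive cocircuit
through p. -/

theorem orthogonal_iff {X Y : α → SignType} :
    Orthogonal X Y ↔ ((∃ e, X e * Y e = 1) ↔ ∃ e, X e * Y e = -1) := by
  have key : ∀ a : SignType, a = 0 ∨ a = 1 ∨ a = -1 := by decide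
  constructor
  · rintro (h | ⟨h₁, h₂⟩)
    · simp [h]
    · simp [h₁, h₂]
  · intro h
    by_cases h₁ : ∃ e, X e * Y e = 1
    · exact Or.inr ⟨h₁, h.1 h₁⟩
    · have h₂ : ¬ ∃ e, X e * Y e = -1 := fun h' => h₁ (h.2 h')
      rw [not_exists] at h₁ h₂
      exact Or.inl fun e => by
        rcases key (X e * Y e) with h | h | h
        · exact h
        · exact absurd h (h₁ e)
        · exact absurd h (h₂ e)

theorem Orthogonal.symm {X Y : α → SignType} (h : Orthogonal X Y) : Orthogonal Y X := by
  simpa only [Orthogonal, mul_comm] using h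

theorem Orthogonal.neg_left {X Y : α → SignType} (h : Orthogonal X Y) : Orthogonal (-X) Y := by
  rw [orthogonal_iff] at h ⊢
  simp only [Pi.neg_apply, neg_mul, neg_eq_iff_eq_neg]
  exact h.symm

/-- Orthogonal sign vectors whose products are all nonnegative have disjoint supports. -/
theorem Orthogonal.eq_zero_of_nonneg {X Y : α → SignType} (h : Orthogonal X Y)
    (hn : ∀ f, 0 ≤ X f * Y f) (e : α) : X e * Y e = 0 := by
  rcases h with h | ⟨-, f, hf⟩
  · exact h e
  · have := hn f
    rw [hf] at this
    exact absurd this (by decide)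

/-- One of the two signs is missing among the products, so up to negating `Y` they are all
nonnegative. A covector refuting a candidate vector can thus be taken conformal to it. -/
theorem exists_of_not_orthogonal {X Y : α → SignType} (h : ¬ Orthogonal X Y) :
    (∃ e, X e * Y e ≠ 0) ∧ ((∀ f, 0 ≤ X f * Y f) ∨ ∀ f, 0 ≤ X f * (-Y) f) := by
  have k₁ : ∀ a : SignType, a ≠ 1 → 0 ≤ -a := by decide
  have k₂ : ∀ a : SignType, a ≠ -1 → 0 ≤ a := by decide
  simp only [Orthogonal, not_or, not_forall, not_and_or, not_exists] at h
  refine ⟨h.1, ?_⟩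
  rcases h.2 with h | h
  · exact Or.inr fun f => by simpa using k₁ _ (h f)
  · exact Or.inl fun f => k₂ _ (h f)

theorem comp_apply_eq_left {X Y : α → SignType} {e : α} (h : X e ≠ 0) : comp X Y e = X e :=
  if_neg h

theorem comp_apply_eq_right {X Y : α → SignType} {e : α} (h : X e = 0) : comp X Y e = Y e :=
  if_pos h

/-- If `X` and `Z` have disjoint supports, the products are those of `Y`. Otherwise the two
witnesses lie in the support of `X`, where the composition agrees with `X`. -/
theorem Orthogonal.comp_left {X Y Z : α → SignType} (hX : Orthogonal X Z) (hY : Orthogonal Y Z) :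
    Orthogonal (comp X Y) Z := by
  rcases hX with hX | ⟨⟨e, he⟩, f, hf⟩
  · have : ∀ e, comp X Y e * Z e = if X e = 0 then Y e * Z e else 0 := fun e => by
      unfold comp
      split_ifs
      · rfl
      · exact hX e
    have h' : ∀ e, comp X Y e * Z e = Y e * Z e := fun e => by
      rw [this e]
      split_ifs with h
      · rfl
      · rcases mul_eq_zero.1 (hX e) with h' | h'
        · exact absurd h' h
        · rw [h', mul_zero]
    simpa only [Orthogonal, h'] using hY
  · refine Or.inr ⟨⟨e, ?_⟩, f, ?_⟩
    · rw [comp_apply_eq_left, he]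
      rintro h
      simp [h] at he
    · rw [comp_apply_eq_left, hf]
      rintro h
      simp [h] at hf

end SignVec

namespace OrientedMatroid

open SignVec

variable {α : Type*}

/-! ### The painting lemma -/

theorem covector_eq_zero (M : OrientedMatroid α) {X : α → SignType} (hX : X ∈ M.covectors) {e : α}
    (he : e ∉ M.E) : X e = 0 := by
  by_contra h
  exact he (M.support_subset X hX h)

/-- Every vector of a single-element contraction extends to a vector. -/
theorem exists_vector_of_contract (M : OrientedMatroid α) {w : α} (hw : w ∈ M.E)
    {V : α → SignType} (hV : V ∈ (M.contract {w}).vectors) :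
    ∃ U ∈ M.vectors, ∀ f, f ≠ w → U f = V f := by
  classical
  have hVw : V w = 0 := by
    by_contra h
    exact (hV.1 h).2 rfl
  have hsupp : ∀ s, Function.support (Function.update V w s) ⊆ M.E := by
    intro s e he
    by_cases h : e = w
    · exact h ▸ hw
    · rw [Function.mem_support, Function.update_of_ne h] at he
      exact (hV.1 he).1
  by_contra hcon
  push Not at hcon
  -- every sign at `w` is refuted by some covector
  have key : ∀ s, ∃ X ∈ M.covectors, (∃ e, Function.update V w s e * X e ≠ 0) ∧
      ∀ f, 0 ≤ Function.update V w s f * X f := by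
    intro s
    have : Function.update V w s ∉ M.vectors := fun h => by
      obtain ⟨f, hf, hne⟩ := hcon _ h
      exact hne (Function.update_of_ne hf _ _)
    simp only [vectors, Set.mem_ofPred_eq, not_and, not_forall] at this
    obtain ⟨X, hX, hno⟩ := this (hsupp s)
    obtain ⟨⟨e, he⟩, h | h⟩ := exists_of_not_orthogonal hno
    · exact ⟨X, hX, ⟨e, he⟩, h⟩
    · exact ⟨-X, M.neg_mem X hX, ⟨e, by simpa using he⟩, h⟩
  have hperp : ∀ X ∈ M.covectors, X w = 0 → (∀ f, f ≠ w → 0 ≤ V f * X f) →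
      ∀ f, V f * X f = 0 := by
    intro X hX hXw hn
    have hX' : X ∈ (M.contract {w}).covectors := ⟨hX, by simpa using hXw⟩
    refine (hV.2 X hX').eq_zero_of_nonneg fun f => ?_
    by_cases hf : f = w
    · simp [hf, hVw]
    · exact hn f hf
  obtain ⟨X, hX, ⟨e, he⟩, hXn⟩ := key 0
  have hew : e ≠ w := by
    rintro rfl
    simp at he
  rw [Function.update_of_ne hew] at he
  have hXn' : ∀ f, f ≠ w → 0 ≤ V f * X f := fun f hf => by
    simpa [Function.update_of_ne hf] using hXn f
  have hXw : X w ≠ 0 := fun h => he (hperp X hX h hXn' e)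
  -- The trial sign `-X w` forces `Y w = -X w`, so `w` can be eliminated between the two
  -- refutations. The result vanishes at `w` and still refutes `V`.
  obtain ⟨Y, hY, ⟨e', he'⟩, hYn⟩ := key (-X w)
  have hYn' : ∀ f, f ≠ w → 0 ≤ V f * Y f := fun f hf => by
    simpa [Function.update_of_ne hf] using hYn f
  have hYw : Y w ≠ 0 := fun h => by
    have h0 := hperp Y hY h hYn' e'
    by_cases hf : e' = w
    · subst hf
      simp [h] at he'
    · rw [Function.update_of_ne hf] at he'
      exact he' h0
  have hsep : w ∈ sep X Y := by
    refine ⟨hXw, ?_⟩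
    have h1 := hYn w
    rw [Function.update_self] at h1
    have : ∀ x y : SignType, x ≠ 0 → y ≠ 0 → 0 ≤ -x * y → x = -y := by decide
    exact this _ _ hXw hYw h1
  obtain ⟨Z, hZ, hZw, hZf⟩ := M.elimination X hX Y hY w hsep
  -- Where `X` and `Y` are opposite, conformity with both forces `V` to vanish, so the uncontrolled
  -- values of `Z` do no harm.
  have hk : ∀ v x y : SignType, 0 ≤ v * x → 0 ≤ v * y → x ≠ 0 → x = -y → v = 0 := by decide
  have hZV : ∀ f, f ≠ w → 0 ≤ V f * Z f ∧ (V f * X f ≠ 0 → V f * Z f ≠ 0) := by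
    intro f hf
    by_cases hfs : f ∈ sep X Y
    · simp [hk _ _ _ (hXn' f hf) (hYn' f hf) hfs.1 hfs.2]
    · rw [hZf f hfs]
      by_cases h0 : X f = 0
      · rw [comp_apply_eq_right h0]
        exact ⟨hYn' f hf, by simp [h0]⟩
      · rw [comp_apply_eq_left h0]
        exact ⟨hXn' f hf, id⟩
  exact (hZV e hew).2 he (hperp Z hZ hZw (fun f hf => (hZV f hf).1) e)

/-- For every set `W` and element `e`, either a covector vanishing on `W \ {e}` or a vector
supported on `W ∪ {e}` takes the value `s` at `e`. -/
theorem exists_covector_or_vector (M : OrientedMatroid α) {e : α} (he : e ∈ M.E) (s : SignType)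
    (W : Set α) (hs : s ≠ 0) :
    (∃ X ∈ M.covectors, X e = s ∧ ∀ f ∈ W, f ≠ e → X f = 0) ∨
      ∃ V ∈ M.vectors, V e = s ∧ ∀ f ∉ W, f ≠ e → V f = 0 := by
  classical
  -- If no covector provides the first alternative, the elements of `W` are contracted one by one
  -- until `e` is a loop. The vector supported on `e` is then lifted back by
  -- `exists_vector_of_contract`; hence the induction over all `M`.
  suffices H : ∀ W : Finset α, ∀ M : OrientedMatroid α, e ∈ M.E → ↑W ⊆ M.E → e ∉ W →
      (∀ X ∈ M.covectors, (∀ f ∈ W, X f = 0) → X e = 0) →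
      ∃ V ∈ M.vectors, V e = s ∧ ∀ f ∉ W, f ≠ e → V f = 0 by
    have hfin : ((M.E ∩ W) \ {e}).Finite :=
      M.finite_ground.subset fun f hf => hf.1.1
    by_cases hX : ∃ X ∈ M.covectors, X e ≠ 0 ∧ ∀ f ∈ hfin.toFinset, X f = 0
    · obtain ⟨X, hX, hXe, hXf⟩ := hX
      have h0 : ∀ f ∈ W, f ≠ e → X f = 0 := fun f hf hfe => by
        by_cases hfE : f ∈ M.E
        · exact hXf f (by simp [hfE, hf, hfe])
        · exact M.covector_eq_zero hX hfE
      left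
      have : ∀ x s : SignType, x ≠ 0 → s ≠ 0 → x = s ∨ -x = s := by decide
      rcases this _ _ hXe hs with h | h
      · exact ⟨X, hX, h, h0⟩
      · exact ⟨-X, M.neg_mem X hX, h, fun f hf hfe => by simp [h0 f hf hfe]⟩
    · push Not at hX
      obtain ⟨V, hV, hVe, hVf⟩ := H hfin.toFinset M he
        (fun f hf => (hfin.mem_toFinset.1 hf).1.1) (by simp)
        (fun X hX' h => by
          by_contra hne
          obtain ⟨f, hf, hf'⟩ := hX X hX' hne
          exact hf' (h f hf))
      exact Or.inr ⟨V, hV, hVe, fun f hf hfe => hVf f (by simp [hf]) hfe⟩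
  intro W
  induction W using Finset.induction_on with
  | empty =>
    intro M he _ _ h
    refine ⟨Pi.single e s, ⟨fun f hf => ?_, fun X hX => Or.inl fun f => ?_⟩, by simp,
      fun f _ hfe => by simp [hfe]⟩
    · by_cases hfe : f = e
      · exact hfe ▸ he
      · simp [hfe] at hf
    · by_cases hfe : f = e
      · subst hfe
        simp [h X hX (by simp)]
      · simp [hfe]
  | insert w W hw ih =>
    intro M he hWE heW h
    simp only [Finset.mem_insert, not_or] at heW
    have hwE : w ∈ M.E := hWE (by simp)
    obtain ⟨V, hV, hVe, hVf⟩ := ih (M.contract {w}) ⟨he, heW.1⟩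
      (fun f hf => ⟨hWE (by simp [Finset.mem_coe.1 hf]), by
        rintro rfl
        exact hw hf⟩) heW.2
      (fun X hX hXW => h X hX.1 (by simpa using ⟨hX.2 w rfl, hXW⟩))
    obtain ⟨U, hU, hUV⟩ := M.exists_vector_of_contract hwE hV
    refine ⟨U, hU, by rw [hUV e heW.1, hVe], fun f hf hfe => ?_⟩
    simp only [Finset.mem_insert, not_or] at hf
    rw [hUV f hf.1, hVf f hf.2 hfe]

theorem vector_eq_zero (M : OrientedMatroid α) {V : α → SignType} (hV : V ∈ M.vectors) {e : α}
    (he : e ∉ M.E) : V e = 0 := by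
  by_contra h
  exact he (hV.1 h)

/-- The painting lemma. The signs of `P` prescribe the elements where a covector or vector has to
conform to `P`; on the zeros of `P`, covectors have to vanish on `W` and vectors off `W`. -/
theorem painting (M : OrientedMatroid α) {e : α} (he : e ∈ M.E) (P : α → SignType) (W : Set α)
    (hP : P e ≠ 0) :
    (∃ X ∈ M.covectors, (∀ f, 0 ≤ X f * P f) ∧ X e = P e ∧ ∀ f ∈ W, P f = 0 → X f = 0) ∨
      ∃ V ∈ M.vectors, (∀ f, 0 ≤ V f * P f) ∧ V e = P e ∧ ∀ f ∉ W, P f = 0 → V f = 0 := by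
  classical
  have hsq : ∀ s : SignType, 0 ≤ s * s := by decide
  -- Induction on the elements other than `e` with a prescribed sign, of which `R` is an upper
  -- bound.
  suffices H : ∀ (R : Finset α) (P : α → SignType) (W : Set α), P e ≠ 0 →
      (∀ f ∈ M.E, P f ≠ 0 → f ≠ e → f ∈ R) →
      (∃ X ∈ M.covectors, (∀ f, 0 ≤ X f * P f) ∧ X e = P e ∧ ∀ f ∈ W, P f = 0 → X f = 0) ∨
      ∃ V ∈ M.vectors, (∀ f, 0 ≤ V f * P f) ∧ V e = P e ∧ ∀ f ∉ W, P f = 0 → V f = 0 from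
    H M.finite_ground.toFinset P W hP fun f hf _ _ => by simpa using hf
  intro R
  induction R using Finset.induction_on with
  | empty =>
    intro P W hP hR
    have h0 : ∀ f ∈ M.E, f ≠ e → P f = 0 := fun f hf hfe => by
      by_contra h
      simpa using hR f hf h hfe
    rcases M.exists_covector_or_vector he (P e) W hP with ⟨X, hX, hXe, hXf⟩ | ⟨V, hV, hVe, hVf⟩
    · refine Or.inl ⟨X, hX, fun f => ?_, hXe, fun f hf hPf => hXf f hf ?_⟩
      · by_cases hfe : f = e
        · rw [hfe, hXe]
          exact hsq _
        · by_cases hf : f ∈ M.E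
          · simp [h0 f hf hfe]
          · simp [M.covector_eq_zero hX hf]
      · rintro rfl
        exact hP hPf
    · refine Or.inr ⟨V, hV, fun f => ?_, hVe, fun f hf hPf => hVf f hf ?_⟩
      · by_cases hfe : f = e
        · rw [hfe, hVe]
          exact hsq _
        · by_cases hf : f ∈ M.E
          · simp [h0 f hf hfe]
          · simp [M.vector_eq_zero hV hf]
      · rintro rfl
        exact hP hPf
  | insert g R hg ih =>
    intro P W hP hR
    by_cases hge : g = e
    · subst hge
      exact ih P W hP fun f hf hPf hfe => Finset.mem_of_mem_insert_of_ne (hR f hf hPf hfe) hfe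
    by_cases hPg : P g = 0
    · refine ih P W hP fun f hf hPf hfe =>
        Finset.mem_of_mem_insert_of_ne (hR f hf hPf hfe) ?_
      rintro rfl
      exact hPf hPg
    have hPe : Function.update P g 0 e ≠ 0 := by rwa [Function.update_of_ne (Ne.symm hge)]
    have hR' : ∀ f ∈ M.E, Function.update P g 0 f ≠ 0 → f ≠ e → f ∈ R := by
      intro f hf hPf hfe
      have hfg : f ≠ g := by
        rintro rfl
        simp at hPf
      rw [Function.update_of_ne hfg] at hPf
      exact Finset.mem_of_mem_insert_of_ne (hR f hf hPf hfe) hfg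
    -- The sign at `g` is erased in two ways: `h1` leaves covectors free at `g` and makes vectors
    -- vanish there, `h2` does the opposite. Only a covector from `h1` and a vector from `h2` can
    -- have a wrong sign at `g`. If both do, their products are all nonnegative and nonzero at `e`,
    -- against orthogonality.
    have h1 := ih (Function.update P g 0) (W \ {g}) hPe hR'
    have h2 := ih (Function.update P g 0) (insert g W) hPe hR'
    rw [Function.update_of_ne (Ne.symm hge)] at h1 h2
    have hoff : ∀ Y : α → SignType, (∀ f, 0 ≤ Y f * Function.update P g 0 f) →
        ∀ f, f ≠ g → 0 ≤ Y f * P f := fun Y hY f hf => by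
      simpa [Function.update_of_ne hf] using hY f
    have hall : ∀ Y : α → SignType, (∀ f, 0 ≤ Y f * Function.update P g 0 f) →
        0 ≤ Y g * P g → ∀ f, 0 ≤ Y f * P f := fun Y hY hYg f => by
      by_cases hf : f = g
      · rwa [hf]
      · exact hoff Y hY f hf
    rcases h1 with ⟨X, hX, hXP, hXe, hXW⟩ | ⟨V, hV, hVP, hVe, hVW⟩
    swap
    · refine Or.inr ⟨V, hV, hall V hVP ?_, hVe, fun f hf hPf => hVW f (fun h => hf h.1) ?_⟩
      · simp [hVW g (by simp) (by simp)]
      · by_cases hfg : f = g <;> simp [hfg, hPf]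
    rcases h2 with ⟨Y, hY, hYP, hYe, hYW⟩ | ⟨V, hV, hVP, hVe, hVW⟩
    · refine Or.inl ⟨Y, hY, hall Y hYP ?_, hYe, fun f hf hPf => hYW f (Or.inr hf) ?_⟩
      · simp [hYW g (by simp) (by simp)]
      · by_cases hfg : f = g <;> simp [hfg, hPf]
    have hX0 : ∀ f ∈ W, P f = 0 → X f = 0 := fun f hf hPf => by
      have hfg : f ≠ g := by
        rintro rfl
        exact hPg hPf
      exact hXW f ⟨hf, hfg⟩ (by simp [hfg, hPf])
    have hV0 : ∀ f ∉ W, P f = 0 → V f = 0 := fun f hf hPf => by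
      have hfg : f ≠ g := by
        rintro rfl
        exact hPg hPf
      exact hVW f (by simp [hf, hfg]) (by simp [hfg, hPf])
    by_cases hXg : 0 ≤ X g * P g
    · exact Or.inl ⟨X, hX, hall X hXP hXg, hXe, hX0⟩
    by_cases hVg : 0 ≤ V g * P g
    · exact Or.inr ⟨V, hV, hall V hVP hVg, hVe, hV0⟩
    exfalso
    have k1 : ∀ v x p : SignType, ¬ 0 ≤ x * p → ¬ 0 ≤ v * p → 0 ≤ v * x := by decide
    have k2 : ∀ v x p : SignType, 0 ≤ x * p → 0 ≤ v * p → p ≠ 0 → 0 ≤ v * x := by decide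
    have h0 := (hV.2 X hX).eq_zero_of_nonneg (fun f => by
      by_cases hf : f = g
      · rw [hf]
        exact k1 _ _ _ hXg hVg
      · by_cases hPf : P f = 0
        · by_cases hfW : f ∈ W
          · simp [hX0 f hfW hPf]
          · simp [hV0 f hfW hPf]
        · exact k2 _ _ _ (hoff X hXP f hf) (hoff V hVP f hf) hPf) e
    rw [hXe, hVe] at h0
    exact hP (by simpa using h0)

/-! ### The dual oriented matroid -/

theorem zero_mem_vectors (M : OrientedMatroid α) : (0 : α → SignType) ∈ M.vectors :=
  ⟨by simp, fun _ _ => Or.inl (by simp)⟩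

theorem comp_mem_vectors (M : OrientedMatroid α) {U V : α → SignType} (hU : U ∈ M.vectors)
    (hV : V ∈ M.vectors) : comp U V ∈ M.vectors := by
  refine ⟨fun e he => ?_, fun X hX => (hU.2 X hX).comp_left (hV.2 X hX)⟩
  by_cases h : U e = 0
  · rw [Function.mem_support, comp_apply_eq_right h] at he
    exact hV.1 he
  · exact hU.1 h

/-- In a set `S` of sign vectors closed under composition, if every element of the support of `X`
in `T` is attained by a member of `S` conforming to `X` on `T`, then some member of `S` equals `X`
on `T`. -/
theorem exists_eq_of_forall_exists {S : Set (α → SignType)} (h0 : (0 : α → SignType) ∈ S)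
    (hc : ∀ X ∈ S, ∀ Y ∈ S, comp X Y ∈ S) {X : α → SignType} {E T : Set α} (hE : E.Finite)
    (hXE : Function.support X ⊆ E) (hTE : ∀ Y ∈ S, ∀ f ∉ E, Y f = 0)
    (h : ∀ e ∈ T, X e ≠ 0 → ∃ Y ∈ S, Y e = X e ∧ ∀ f ∈ T, Y f = 0 ∨ Y f = X f) :
    ∃ Y ∈ S, ∀ f ∈ T, Y f = X f := by
  classical
  suffices H : ∀ A : Finset α, ∃ Y ∈ S, (∀ f ∈ T, Y f = 0 ∨ Y f = X f) ∧
      ∀ f ∈ A, f ∈ T → Y f = X f by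
    obtain ⟨Y, hY, -, hYX⟩ := H hE.toFinset
    refine ⟨Y, hY, fun f hf => ?_⟩
    by_cases hfE : f ∈ E
    · exact hYX f (by simpa using hfE) hf
    · rw [hTE Y hY f hfE]
      by_contra hne
      exact hfE (hXE (Ne.symm hne))
  intro A
  induction A using Finset.induction_on with
  | empty => exact ⟨0, h0, by simp, by simp⟩
  | insert e A _ ih =>
    obtain ⟨Y, hY, hYT, hYA⟩ := ih
    by_cases he : e ∈ T ∧ X e ≠ 0
    · obtain ⟨Z, hZ, hZe, hZT⟩ := h e he.1 he.2
      refine ⟨comp Y Z, hc Y hY Z hZ, fun f hf => ?_, fun f hf hfT => ?_⟩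
      · by_cases hYf : Y f = 0
        · rw [comp_apply_eq_right hYf]
          exact hZT f hf
        · rw [comp_apply_eq_left hYf]
          exact hYT f hf
      · by_cases hYf : Y f = 0
        · rw [comp_apply_eq_right hYf]
          rcases Finset.mem_insert.1 hf with rfl | hf
          · exact hZe
          · have := hYA f hf hfT
            rcases hZT f hfT with h | h
            · rw [h, ← this, hYf]
            · exact h
        · rw [comp_apply_eq_left hYf]
          exact (hYT f hfT).resolve_left hYf
    · refine ⟨Y, hY, hYT, fun f hf hfT => ?_⟩
      rcases Finset.mem_insert.1 hf with rfl | hf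
      · have hX : X f = 0 := by
          by_contra h
          exact he ⟨hfT, h⟩
        rcases hYT f hfT with h | h
        · rw [h, hX]
        · exact h
      · exact hYA f hf hfT

/-- Vectors vanishing at `e` are closed under composition. So it is enough to find, through each `f`
off the separation set where `comp U V` is nonzero, one such vector conforming to `comp U V` off
that set; the painting lemma provides it. -/
theorem vector_elimination (M : OrientedMatroid α) {U V : α → SignType} (hU : U ∈ M.vectors)
    (hV : V ∈ M.vectors) {e : α} (he : e ∈ sep U V) :
    ∃ Z ∈ M.vectors, Z e = 0 ∧ ∀ f ∉ sep U V, Z f = comp U V f := by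
  classical
  have hUV := M.comp_mem_vectors hU hV
  have hconf : ∀ f ∉ sep U V, V f ≠ 0 → comp U V f = V f := fun f hf hVf => by
    by_cases h : U f = 0
    · exact comp_apply_eq_right h
    · rw [comp_apply_eq_left h]
      have : ∀ u v : SignType, u ≠ 0 → v ≠ 0 → ¬ (u ≠ 0 ∧ u = -v) → u = v := by decide
      exact this _ _ h hVf hf
  obtain ⟨Z, ⟨hZ, hZe⟩, hZf⟩ := exists_eq_of_forall_exists
    (S := {Z | Z ∈ M.vectors ∧ Z e = 0}) (X := comp U V) (E := M.E) (T := (sep U V)ᶜ)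
    ⟨M.zero_mem_vectors, rfl⟩
    (fun X hX Y hY => ⟨M.comp_mem_vectors hX.1 hY.1, by
      rw [comp_apply_eq_right hX.2, hY.2]⟩)
    M.finite_ground hUV.1 (fun Y hY f hf => M.vector_eq_zero hY.1 hf) (by
      intro f hf hne
      set P : α → SignType := fun g => if g ∈ sep U V then 0 else comp U V g with hPdef
      have hPs : ∀ g ∈ sep U V, P g = 0 := fun g hg => if_pos hg
      have hPn : ∀ g ∉ sep U V, P g = comp U V g := fun g hg => if_neg hg
      have hf' : f ∉ sep U V := hf
      -- With `W = sep U V \ {e}`, vectors are free on the separation set except at `e`. A covector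
      -- alternative `X` would conform to both `U` and `V` away from `e`. Since `U e = -V e`, one
      -- product at `e` is nonnegative, which forces `X e = 0` and then `U f = V f = 0`.
      rcases M.painting (hUV.1 hne) P (sep U V \ {e}) (by rwa [hPn f hf']) with
        ⟨X, hX, hXP, hXf, hXW⟩ | ⟨Z, hZ, hZP, hZf, hZW⟩
      · exfalso
        have hXs : ∀ g ∈ sep U V, g ≠ e → X g = 0 := fun g hg hge =>
          hXW g ⟨hg, hge⟩ (hPs g hg)
        have hUX : ∀ g, g ≠ e → 0 ≤ U g * X g := fun g hge => by
          by_cases hg : g ∈ sep U V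
          · simp [hXs g hg hge]
          · by_cases h : U g = 0
            · simp [h]
            · have := hXP g
              rwa [hPn g hg, comp_apply_eq_left h, mul_comm] at this
        have hVX : ∀ g, g ≠ e → 0 ≤ V g * X g := fun g hge => by
          by_cases hg : g ∈ sep U V
          · simp [hXs g hg hge]
          · by_cases h : V g = 0
            · simp [h]
            · have := hXP g
              rwa [hPn g hg, hconf g hg h, mul_comm] at this
        have hXf0 : X f ≠ 0 := by rwa [hXf, hPn f hf']
        have hVe : V e ≠ 0 := fun h => he.1 (by rw [he.2, h, neg_zero])
        have hU0 : 0 ≤ U e * X e → X e = 0 ∧ U f = 0 := fun h => by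
          have := (hU.2 X hX).eq_zero_of_nonneg (fun g => by
            by_cases hge : g = e
            · rwa [hge]
            · exact hUX g hge)
          exact ⟨(mul_eq_zero.1 (this e)).resolve_left he.1,
            (mul_eq_zero.1 (this f)).resolve_right hXf0⟩
        have hV0 : 0 ≤ V e * X e → X e = 0 ∧ V f = 0 := fun h => by
          have := (hV.2 X hX).eq_zero_of_nonneg (fun g => by
            by_cases hge : g = e
            · rwa [hge]
            · exact hVX g hge)
          exact ⟨(mul_eq_zero.1 (this e)).resolve_left hVe,
            (mul_eq_zero.1 (this f)).resolve_right hXf0⟩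
        have hXe : X e = 0 := by
          have k : ∀ u v x : SignType, u = -v → 0 ≤ u * x ∨ 0 ≤ v * x := by decide
          rcases k _ _ (X e) he.2 with h | h
          · exact (hU0 h).1
          · exact (hV0 h).1
        rw [comp_apply_eq_right (hU0 (by simp [hXe])).2] at hne
        exact hne (hV0 (by simp [hXe])).2
      · refine ⟨Z, ⟨hZ, hZW e (by simp) (hPs e he)⟩, by rw [hZf, hPn f hf'], fun g hg => ?_⟩
        have h1 := hZP g
        rw [hPn g hg] at h1
        by_cases h0 : comp U V g = 0
        · left
          exact hZW g (fun h => hg h.1) (by rw [hPn g hg, h0])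
        · have : ∀ z p : SignType, 0 ≤ z * p → p ≠ 0 → z = 0 ∨ z = p := by decide
          exact this _ _ h1 h0)
  exact ⟨Z, hZ, hZe, fun f hf => hZf f hf⟩

theorem support_neg (X : α → SignType) : Function.support (-X) = Function.support X := by
  ext e
  simp

/-- The dual oriented matroid, whose covectors are the vectors. -/
def dual (M : OrientedMatroid α) : OrientedMatroid α where
  E := M.E
  finite_ground := M.finite_ground
  covectors := M.vectors
  support_subset := fun _ hV => hV.1
  zero_mem := M.zero_mem_vectors
  neg_mem := fun _ hV => ⟨by simpa using hV.1, fun X hX => (hV.2 X hX).neg_left⟩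
  comp_mem := fun _ hU _ hV => M.comp_mem_vectors hU hV
  elimination := fun _ hU _ hV _ he => M.vector_elimination hU hV he

theorem ext_covectors {M N : OrientedMatroid α} (hE : M.E = N.E)
    (hc : M.covectors = N.covectors) : M = N := by
  cases M
  cases N
  cases hE
  cases hc
  rfl

/-- Painting with the signs of `X` gives, at each element of its support, a covector conforming to
`X` or a vector whose products with `X` are nonnegative and not all zero. Orthogonality excludes the
latter, and the covectors obtained compose to `X`. -/
theorem vectors_dual (M : OrientedMatroid α) : M.dual.vectors = M.covectors := by
  ext X
  constructor
  · intro hX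
    obtain ⟨Y, hY, hYX⟩ := exists_eq_of_forall_exists
      (S := M.covectors) (X := X) (E := M.E) (T := Set.univ) M.zero_mem
      M.comp_mem M.finite_ground hX.1 (fun Y hY f hf => M.covector_eq_zero hY hf) (by
        intro e _ he
        rcases M.painting (hX.1 he) X Set.univ he with ⟨Y, hY, hYX, hYe, hY0⟩ | ⟨V, hV, hVX, hVe, -⟩
        · refine ⟨Y, hY, hYe, fun f _ => ?_⟩
          by_cases hf : X f = 0
          · exact Or.inl (hY0 f trivial hf)
          · have : ∀ z p : SignType, 0 ≤ z * p → p ≠ 0 → z = 0 ∨ z = p := by decide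
            exact this _ _ (hYX f) hf
        · have := (hX.2 V hV).symm.eq_zero_of_nonneg hVX e
          rw [hVe] at this
          exact absurd (by simpa using this) he)
    rwa [← funext fun f => hYX f trivial]
  · exact fun hX => ⟨M.support_subset X hX, fun V hV => (hV.2 X hX).symm⟩

@[simp]
theorem dual_dual (M : OrientedMatroid α) : M.dual.dual = M :=
  ext_covectors rfl M.vectors_dual

theorem isPosCircuit_dual (M : OrientedMatroid α) {D : Set α} :
    M.dual.IsPosCircuit D ↔ M.IsPosCocircuit D := by
  simp only [IsPosCircuit, IsCircuit, vectors_dual, IsPosCocircuit, IsCocircuit]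

/-! ### Duality of minors -/

theorem dual_restrict (M : OrientedMatroid α) (F : Set α) :
    (M.restrict F).dual = M.dual.contract Fᶜ := by
  refine ext_covectors (by ext; simp [dual, restrict, contract]) ?_
  have key : ∀ V : α → SignType, (∀ e ∉ F, V e = 0) → ∀ X e,
      V e * F.indicator X e = V e * X e := fun V hV X e => by
    by_cases he : e ∈ F
    · simp [he]
    · simp [hV e he]
  ext V
  constructor
  · rintro ⟨hV, hperp⟩
    have h0 : ∀ e ∉ F, V e = 0 := fun e he => by
      by_contra h
      exact he (hV h).2
    refine ⟨⟨fun e he => (hV he).1, fun X hX => ?_⟩, h0⟩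
    simpa only [Orthogonal, key V h0] using hperp _ ⟨X, hX, rfl⟩
  · rintro ⟨⟨hV, hperp⟩, h0⟩
    refine ⟨fun e he => ⟨hV he, ?_⟩, ?_⟩
    · by_contra h
      exact he (h0 e h)
    · rintro _ ⟨X, hX, rfl⟩
      simpa only [Orthogonal, key V h0] using hperp X hX

theorem dual_contract (M : OrientedMatroid α) (A : Set α) :
    (M.contract A).dual = M.dual.restrict Aᶜ := by
  rw [← dual_dual (M.dual.restrict Aᶜ), dual_restrict, dual_dual, compl_compl]

theorem restrict_contract_comm (M : OrientedMatroid α) {A B : Set α} (h : A ⊆ B) :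
    (M.contract A).restrict B = (M.restrict B).contract A := by
  refine ext_covectors (by ext; simp [restrict, contract]; tauto) ?_
  ext X
  constructor
  · rintro ⟨Y, ⟨hY, hYA⟩, rfl⟩
    exact ⟨⟨Y, hY, rfl⟩, fun e he => by simp [hYA e he]⟩
  · rintro ⟨⟨Y, hY, rfl⟩, h0⟩
    refine ⟨Y, ⟨hY, fun e he => ?_⟩, rfl⟩
    have := h0 e he
    simpa [h he] using this

theorem restrict_eq_of_inter_eq (M : OrientedMatroid α) {A B : Set α} (h : M.E ∩ A = M.E ∩ B) :
    M.restrict A = M.restrict B := by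
  refine ext_covectors h (Set.image_congr fun X hX => ?_)
  funext e
  by_cases he : e ∈ M.E
  · have : e ∈ A ↔ e ∈ B := by simpa [he] using Set.ext_iff.1 h e
    by_cases hA : e ∈ A
    · rw [Set.indicator_of_mem hA, Set.indicator_of_mem (this.1 hA)]
    · rw [Set.indicator_of_notMem hA, Set.indicator_of_notMem (fun hB => hA (this.2 hB))]
  · simp [Set.indicator, M.covector_eq_zero hX he]

/-- The dual of the minor `M(G)/F` is `M*(E \ F)/(E \ G)`. -/
theorem dual_minor (M : OrientedMatroid α) {F G : Set α} (h : F ⊆ G) :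
    ((M.restrict G).contract F).dual = (M.dual.restrict (M.E \ F)).contract (M.E \ G) := by
  rw [dual_contract, dual_restrict, ← restrict_contract_comm _ (Set.sdiff_subset_sdiff_right h)]
  have hc : M.dual.contract Gᶜ = M.dual.contract (M.E \ G) := by
    refine ext_covectors (by ext; simp [contract, dual]) ?_
    ext X
    refine and_congr_right fun hX => ⟨fun h0 e he => h0 e he.2, fun h0 e he => ?_⟩
    by_cases heE : e ∈ M.E
    · exact h0 e ⟨heE, he⟩
    · exact M.dual.covector_eq_zero hX heE
  rw [hc]
  refine restrict_eq_of_inter_eq _ ?_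
  ext e
  simp [contract, dual]
  tauto

/-! ### Positive circuits and positive cocircuits -/

/-- Conformal decomposition: each element of the support of a covector lies in a cocircuit
conforming to it. -/
theorem exists_isCocircuit_conformal (M : OrientedMatroid α) {X : α → SignType}
    (hX : X ∈ M.covectors) {e : α} (he : X e ≠ 0) :
    ∃ D, M.IsCocircuit D ∧ D e = X e ∧ ∀ f, D f = 0 ∨ D f = X f := by
  classical
  have hfin : ∀ Y ∈ M.covectors, (Function.support Y).Finite := fun Y hY =>
    M.finite_ground.subset (M.support_subset Y hY)
  let S : Set (α → SignType) := {Z | Z ∈ M.covectors ∧ Z e = X e ∧ ∀ f, Z f = 0 ∨ Z f = X f}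
  obtain ⟨Z, ⟨hZ, hZe, hZX⟩, hmin⟩ := exists_minimalFor_of_wellFoundedLT (· ∈ S)
    (fun Z => (Function.support Z).ncard) ⟨X, hX, rfl, fun f => Or.inr rfl⟩
  have hZe0 : Z e ≠ 0 := by rwa [hZe]
  refine ⟨Z, ⟨hZ, fun h => hZe0 (by simp [h]), fun Y hY hY0 hYZ => ?_⟩, hZe, hZX⟩
  by_contra hne
  -- If `Z` were not a cocircuit, `T` would be nonempty. A member of `T` least separated from `Z`
  -- has empty separation set, as `elim` would shrink it further; it then conforms to `X` and
  -- contradicts the minimality of `Z`.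
  let T : Set (α → SignType) := {W | W ∈ M.covectors ∧ Function.support W ⊂ Function.support Z ∧
    W e = Z e}
  have elim : ∀ Y ∈ M.covectors, Function.support Y ⊆ Function.support Z → e ∉ sep Y Z →
      ∀ f ∈ sep Y Z, ∃ W ∈ T, sep W Z ⊂ sep Y Z := by
    intro Y hY hYZ heS f hf
    obtain ⟨W, hW, hWf, hWg⟩ := M.elimination Y hY Z hZ f hf
    have hZf : Z f ≠ 0 := hYZ hf.1
    have hcomp : ∀ g ∉ sep Y Z, W g = Z g := fun g hg => by
      rw [hWg g hg]
      by_cases h : Y g = 0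
      · exact comp_apply_eq_right h
      · rw [comp_apply_eq_left h]
        have : ∀ u v : SignType, u ≠ 0 → v ≠ 0 → ¬ (u ≠ 0 ∧ u = -v) → u = v := by decide
        exact this _ _ h (hYZ h) hg
    refine ⟨W, ⟨hW, ⟨fun g hg => ?_, fun h => h hZf hWf⟩, hcomp e heS⟩,
      fun g hg => ?_, fun h => (h hf).1 hWf⟩
    · by_cases hgs : g ∈ sep Y Z
      · exact hYZ hgs.1
      · rwa [Function.mem_support, hcomp g hgs] at hg
    · by_contra hgs
      have h1 := hcomp g hgs
      have : ∀ u v : SignType, u = v → ¬ (u ≠ 0 ∧ u = -v) := by decide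
      exact this _ _ h1 hg
  have hns : ∀ a b : SignType, a = b → ¬ (a ≠ 0 ∧ a = -b) := by decide
  have hT : ∃ W, W ∈ T := by
    have hss : Function.support Y ⊂ Function.support Z := hYZ.ssubset_of_ne hne
    -- If `Y` misses `e`, eliminating an element between `±Y` and `Z` restores the value of `Z` at
    -- `e`; otherwise `±Y` already agrees with `Z` there.
    by_cases hYe : Y e = 0
    · obtain ⟨f, hf⟩ := Function.ne_iff.1 hY0
      have k : ∀ y z : SignType, y ≠ 0 → z ≠ 0 → y = -z ∨ -y = -z := by decide
      rcases k (Y f) (Z f) hf (hYZ hf) with h | h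
      · obtain ⟨W, hW, -⟩ := elim Y hY hYZ (fun h => h.1 hYe) f ⟨hf, h⟩
        exact ⟨W, hW⟩
      · obtain ⟨W, hW, -⟩ := elim (-Y) (M.neg_mem Y hY) (by simpa using hYZ)
          (fun h => h.1 (by simp [hYe])) f ⟨by simpa using hf, h⟩
        exact ⟨W, hW⟩
    · have k : ∀ y z : SignType, y ≠ 0 → z ≠ 0 → y = z ∨ -y = z := by decide
      rcases k _ _ hYe hZe0 with h | h
      · exact ⟨Y, hY, hss, h⟩
      · exact ⟨-Y, M.neg_mem Y hY, by rwa [support_neg], h⟩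
  obtain ⟨W, hWT, hWmin⟩ := exists_minimalFor_of_wellFoundedLT (· ∈ T)
    (fun W => (sep W Z).ncard) hT
  by_cases hs : ∃ f, f ∈ sep W Z
  · obtain ⟨f, hf⟩ := hs
    obtain ⟨W', hW', hlt⟩ := elim W hWT.1 hWT.2.1.1 (hns _ _ hWT.2.2) f hf
    have h1 := Set.ncard_lt_ncard hlt ((hfin W hWT.1).subset fun g hg => hg.1)
    have h2 := hWmin hW' h1.le
    exact absurd h1 (not_lt.2 h2)
  · have hconf : ∀ f, W f = 0 ∨ W f = Z f := fun f => by
      by_cases h : W f = 0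
      · exact Or.inl h
      · have : ∀ u v : SignType, u ≠ 0 → v ≠ 0 → ¬ (u ≠ 0 ∧ u = -v) → u = v := by decide
        exact Or.inr (this _ _ h (hWT.2.1.1 h) fun hf => hs ⟨f, hf⟩)
    have hWS : W ∈ S := ⟨hWT.1, by rw [hWT.2.2, hZe], fun f => by
      rcases hconf f with h | h
      · exact Or.inl h
      · rw [h]
        exact hZX f⟩
    have h1 := Set.ncard_lt_ncard hWT.2.1 (hfin Z hZ)
    exact absurd h1 (not_lt.2 (hmin hWS h1.le))

/-- Each element of the support of a nonnegative covector lies in a positive cocircuit contained in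
this support. -/
theorem exists_isPosCocircuit (M : OrientedMatroid α) {X : α → SignType} (hX : X ∈ M.covectors)
    (hn : ∀ f, 0 ≤ X f) {e : α} (he : X e ≠ 0) :
    ∃ D, M.IsPosCocircuit D ∧ e ∈ D ∧ D ⊆ Function.support X := by
  obtain ⟨D, hD, hDe, hDX⟩ := M.exists_isCocircuit_conformal hX he
  refine ⟨_, ⟨D, hD, fun f => ?_, rfl⟩, by rwa [Function.mem_support, hDe], fun f hf => ?_⟩
  · rcases hDX f with h | h
    · exact h.ge
    · exact h ▸ hn f
  · rcases hDX f with h | h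
    · exact absurd h hf
    · rwa [Function.mem_support, ← h]

/-- A positive circuit and a positive cocircuit are disjoint. -/
theorem disjoint_posCircuit_posCocircuit (M : OrientedMatroid α) {C D : Set α}
    (hC : M.IsPosCircuit C) (hD : M.IsPosCocircuit D) : Disjoint C D := by
  obtain ⟨V, hV, hV0, rfl⟩ := hC
  obtain ⟨X, hX, hX0, rfl⟩ := hD
  rw [Set.disjoint_left]
  intro e he he'
  have k : ∀ a b : SignType, 0 ≤ a → 0 ≤ b → 0 ≤ a * b := by decide
  have := (hV.1.2 X hX.1).eq_zero_of_nonneg (fun f => k _ _ (hV0 f) (hX0 f)) e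
  rcases mul_eq_zero.1 this with h | h
  · exact he h
  · exact he' h

/-- Every element lies in a positive circuit or in a positive cocircuit. -/
theorem exists_posCircuit_or_posCocircuit (M : OrientedMatroid α) {e : α} (he : e ∈ M.E) :
    (∃ C, M.IsPosCircuit C ∧ e ∈ C) ∨ ∃ D, M.IsPosCocircuit D ∧ e ∈ D := by
  -- All signs are prescribed to be `+`, so no zeros remain and the set `∅` has no effect.
  rcases M.painting he (fun _ => 1) ∅ (by decide) with ⟨X, hX, hXn, hXe, -⟩ | ⟨V, hV, hVn, hVe, -⟩
  · obtain ⟨D, hD, heD, -⟩ := M.exists_isPosCocircuit hX (by simpa using hXn)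
      (e := e) (by rw [hXe]; decide)
    exact Or.inr ⟨D, hD, heD⟩
  · obtain ⟨D, hD, heD, -⟩ := M.dual.exists_isPosCocircuit hV (by simpa using hVn)
      (e := e) (by rw [hVe]; decide)
    exact Or.inl ⟨D, hD, heD⟩

theorem IsPosCocircuit.nonempty {M : OrientedMatroid α} {D : Set α} (hD : M.IsPosCocircuit D) :
    D.Nonempty := by
  obtain ⟨X, hX, -, rfl⟩ := hD
  exact Function.support_nonempty_iff.2 hX.2.1

theorem IsPosCocircuit.subset_ground {M : OrientedMatroid α} {D : Set α}
    (hD : M.IsPosCocircuit D) : D ⊆ M.E := by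
  obtain ⟨X, hX, -, rfl⟩ := hD
  exact M.support_subset X hX.1

/-- Positive circuits and positive cocircuits are disjoint and cover the ground set, so being
totally cyclic means having no positive cocircuit. -/
theorem dualBounded_iff (M : OrientedMatroid α) {p : α} : M.DualBounded p ↔ M.dual.Bounded p := by
  refine and_congr Iff.rfl (and_congr ⟨fun h D hD => ?_, fun h e he => ?_⟩ Iff.rfl)
  · rw [isPosCircuit_dual] at hD
    obtain ⟨e, he⟩ := hD.nonempty
    obtain ⟨C, hC, heC⟩ := h e (hD.subset_ground he)
    exact Set.disjoint_left.1 (M.disjoint_posCircuit_posCocircuit hC hD) heC he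
  · rcases M.exists_posCircuit_or_posCocircuit he with h' | ⟨D, hD, -⟩
    · exact h'
    · exact absurd (M.isPosCircuit_dual.2 hD) (h D)

/-- Every union of positive cocircuits is the support of a nonnegative covector. -/
theorem exists_covector_support_eq (M : OrientedMatroid α) {U : Set α}
    (hU : ∀ e ∈ U, ∃ D, M.IsPosCocircuit D ∧ e ∈ D ∧ D ⊆ U) :
    ∃ X ∈ M.covectors, (∀ f, 0 ≤ X f) ∧ Function.support X = U := by
  classical
  obtain ⟨Y, hY, hYX⟩ := exists_eq_of_forall_exists
      (S := M.covectors) (X := U.indicator fun _ => 1) (E := M.E) (T := Set.univ) M.zero_mem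
      M.comp_mem M.finite_ground (fun e he => by
        obtain ⟨D, hD, heD, -⟩ := hU e (Set.mem_of_indicator_ne_zero he)
        exact hD.subset_ground heD) (fun Y hY f hf => M.covector_eq_zero hY hf) (by
        intro e _ he
        have heU := Set.mem_of_indicator_ne_zero he
        obtain ⟨D, ⟨X, hX, hXn, rfl⟩, heD, hDU⟩ := hU e heU
        have k : ∀ x : SignType, 0 ≤ x → x ≠ 0 → x = 1 := by decide
        refine ⟨X, hX.1, by simpa [heU] using k _ (hXn e) heD, fun f _ => ?_⟩
        by_cases hf : X f = 0
        · exact Or.inl hf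
        · exact Or.inr (by simpa [hDU hf] using k _ (hXn f) hf))
  obtain rfl : Y = _ := funext fun f => hYX f trivial
  refine ⟨_, hY, fun f => ?_, ?_⟩
  · by_cases hf : f ∈ U <;> simp [hf]
  · ext f
    by_cases hf : f ∈ U <;> simp [hf]

/-- Without positive circuits, positive cocircuits cover the ground set and compose to a covector.
Conversely, such a covector puts every element in a positive cocircuit, leaving no room for a
positive circuit. -/
theorem acyclic_iff (M : OrientedMatroid α) :
    M.Acyclic ↔ ∃ X ∈ M.covectors, (∀ f, 0 ≤ X f) ∧ ∀ e ∈ M.E, X e ≠ 0 := by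
  constructor
  · intro h
    obtain ⟨X, hX, hXn, hXs⟩ := M.exists_covector_support_eq (U := M.E) (fun e he => by
      rcases M.exists_posCircuit_or_posCocircuit he with ⟨C, hC, -⟩ | ⟨D, hD, heD⟩
      · exact absurd hC (h C)
      · exact ⟨D, hD, heD, hD.subset_ground⟩)
    exact ⟨X, hX, hXn, fun e he => by rwa [← Function.mem_support, hXs]⟩
  · rintro ⟨X, hX, hXn, hXE⟩ C hC
    obtain ⟨e, he⟩ := IsPosCocircuit.nonempty (M := M.dual) hC
    obtain ⟨D, hD, heD, -⟩ := M.exists_isPosCocircuit hX hXn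
      (hXE e (IsPosCocircuit.subset_ground (M := M.dual) hC he))
    exact Set.disjoint_left.1 (M.disjoint_posCircuit_posCocircuit hC hD) he heD

/-! ### Connectivity -/

theorem IsCocircuit.finite_support {M : OrientedMatroid α} {D : α → SignType}
    (hD : M.IsCocircuit D) : (Function.support D).Finite :=
  M.finite_ground.subset (M.support_subset D hD.1)

/-- Sharing a cocircuit is a transitive relation. -/
theorem exists_common_cocircuit (M : OrientedMatroid α) {e f g : α} {C D : α → SignType}
    (hC : M.IsCocircuit C) (hD : M.IsCocircuit D) (heC : C e ≠ 0) (hfC : C f ≠ 0)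
    (hfD : D f ≠ 0) (hgD : D g ≠ 0) : ∃ Z, M.IsCocircuit Z ∧ Z e ≠ 0 ∧ Z g ≠ 0 := by
  by_contra hcon
  push Not at hcon
  -- Intersecting pairs joining `e` to `g`, to be taken with the smallest union of supports.
  let S : Set ((α → SignType) × (α → SignType)) := {p | M.IsCocircuit p.1 ∧ M.IsCocircuit p.2 ∧
    p.1 e ≠ 0 ∧ p.2 g ≠ 0 ∧ ∃ f, p.1 f ≠ 0 ∧ p.2 f ≠ 0}
  let u : (α → SignType) × (α → SignType) → Set α := fun p =>
    Function.support p.1 ∪ Function.support p.2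
  obtain ⟨⟨C, D⟩, ⟨hC, hD, heC, hgD, f, hfC, hfD⟩, hmin⟩ :=
    exists_minimalFor_of_wellFoundedLT (· ∈ S) (fun p => (u p).ncard)
      ⟨(C, D), hC, hD, heC, hgD, f, hfC, hfD⟩
  simp only at hC hD heC hgD hfC hfD
  have hfinite : (u (C, D)).Finite :=
    hC.finite_support.union hD.finite_support
  have hmin' : ∀ p ∈ S, u p ⊆ u (C, D) → u p = u (C, D) := fun p hp hsub =>
    Set.eq_of_subset_of_ncard_le hsub (hmin hp (Set.ncard_le_ncard hsub hfinite)) hfinite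
  have hDe : D e = 0 := by
    by_contra h
    exact hgD (hcon D hD h)
  have hCg : C g = 0 := hcon C hC heC
  -- elimination of `f` preserving an element of the first support
  have elim : ∀ C D : α → SignType, M.IsCocircuit C → M.IsCocircuit D → ∀ e f, C e ≠ 0 → D e = 0 →
      C f ≠ 0 → D f ≠ 0 → ∃ Z, M.IsCocircuit Z ∧ Z e ≠ 0 ∧ Z f = 0 ∧
        Function.support Z ⊆ Function.support C ∪ Function.support D ∧ ∃ h, Z h ≠ 0 ∧ C h = 0 := by
    intro C D hC hD e f heC hDe hfC hfD
    obtain ⟨D', hD', hfs, hsupp⟩ : ∃ D' ∈ M.covectors, f ∈ sep C D' ∧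
        Function.support D' = Function.support D := by
      have k : ∀ c d : SignType, c ≠ 0 → d ≠ 0 → c = -d ∨ c = -(-d) := by decide
      rcases k _ _ hfC hfD with h | h
      · exact ⟨D, hD.1, ⟨hfC, h⟩, rfl⟩
      · exact ⟨-D, M.neg_mem D hD.1, ⟨hfC, h⟩, support_neg D⟩
    have hD'e : D' e = 0 := by
      by_contra h
      exact (hsupp.subset h) hDe
    obtain ⟨Y, hY, hYf, hYg⟩ := M.elimination C hC.1 D' hD' f hfs
    have hYe : Y e ≠ 0 := by
      have hes : e ∉ sep C D' := fun h => h.1 (by rw [h.2, hD'e, neg_zero])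
      rwa [hYg e hes, comp_apply_eq_left heC]
    have hYs : Function.support Y ⊆ Function.support C ∪ Function.support D := by
      intro g hg
      by_cases hgs : g ∈ sep C D'
      · exact Or.inl hgs.1
      · rw [Function.mem_support, hYg g hgs] at hg
        by_cases h : C g = 0
        · rw [comp_apply_eq_right h] at hg
          exact Or.inr (hsupp.subset hg)
        · exact Or.inl h
    obtain ⟨Z, hZ, hZe, hZY⟩ := M.exists_isCocircuit_conformal hY hYe
    have hZsY : ∀ g, Z g ≠ 0 → Y g ≠ 0 := fun g hg => by
      rwa [← (hZY g).resolve_left hg]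
    have hZf : Z f = 0 := by
      by_contra h
      exact hZsY f h hYf
    refine ⟨Z, hZ, by rwa [hZe], hZf, fun g hg => hYs (hZsY g hg), ?_⟩
    by_contra hno
    push Not at hno
    have hsub : Function.support Z ⊆ Function.support C := hno
    have := hC.2.2 Z hZ.1 hZ.2.1 hsub
    exact (this.symm.subset hfC) hZf
  -- `C'` avoids `f` but meets `D` outside `C`, so (C', D) is again in `S` with the same union by
  -- minimality. Hence `h'`, which is in `D'` but not in `D`, lies in `C'`. So (C', D') is in `S`
  -- too, and its union must contain `f`, which both supports avoid.
  obtain ⟨C', hC', heC', hfC', hC's, h, hhC', hhC⟩ := elim C D hC hD e f heC hDe hfC hfD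
  obtain ⟨D', hD', hgD', hfD', hD's, h', hhD', hhD⟩ := elim D C hD hC g f hgD hCg hfD hfC
  have hu : u (C', D) = u (C, D) := hmin' _
    ⟨hC', hD, heC', hgD, h, hhC', (hC's hhC').resolve_left fun h => h hhC⟩
    (Set.union_subset hC's Set.subset_union_right)
  have hh'C' : C' h' ≠ 0 := by
    have : h' ∈ u (C, D) := Or.inl ((hD's hhD').resolve_left fun h => h hhD)
    rw [← hu] at this
    exact this.resolve_right fun h => h hhD
  have hu' : u (C', D') = u (C, D) := hmin' _ ⟨hC', hD', heC', hgD', h', hh'C', hhD'⟩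
    (Set.union_subset hC's (by rwa [Set.union_comm] at hD's))
  have hfu : f ∈ u (C', D') := hu' ▸ Or.inl hfC
  rcases hfu with h | h
  · exact h hfC'
  · exact h hfD'

/-- Every element of a bounded oriented matroid shares a cocircuit with every other one. -/
theorem Bounded.connected_dual {M : OrientedMatroid α} {p : α} (h : M.Bounded p) :
    M.dual.Connected := by
  obtain ⟨-, hac, hp⟩ := h
  obtain ⟨X, hX, hXn, hXE⟩ := M.acyclic_iff.1 hac
  have key : ∀ e ∈ M.E, ∃ D, M.IsCocircuit D ∧ D e ≠ 0 ∧ D p ≠ 0 := fun e he => by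
    obtain ⟨_, hD, heD, -⟩ := M.exists_isPosCocircuit hX hXn (hXE e he)
    have hpD := hp _ hD
    obtain ⟨D, hD, -, rfl⟩ := hD
    exact ⟨D, hD, heD, hpD⟩
  intro e he f hf _
  obtain ⟨C, hC, heC, hpC⟩ := key e he
  obtain ⟨D, hD, hfD, hpD⟩ := key f hf
  obtain ⟨Z, hZ, hZe, hZf⟩ := M.exists_common_cocircuit hC hD heC hpC hpD hfD
  refine ⟨Z, ?_, hZe, hZf⟩
  rwa [IsCircuit, vectors_dual]

/-- A sign vector orthogonal to all circuits is a covector. -/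
theorem mem_covectors_of_orthogonal_circuits (M : OrientedMatroid α) {X : α → SignType}
    (hX : Function.support X ⊆ M.E) (h : ∀ C, M.IsCircuit C → Orthogonal C X) :
    X ∈ M.covectors := by
  rw [← vectors_dual]
  refine ⟨hX, fun V hV => Orthogonal.symm ?_⟩
  by_contra hno
  obtain ⟨⟨e, he⟩, hsign⟩ := exists_of_not_orthogonal hno
  obtain ⟨C, hC, hCe, hCV⟩ := M.dual.exists_isCocircuit_conformal hV (left_ne_zero_of_mul he)
  have hCX := h C hC
  -- A circuit conforming to `V` inherits the one-sided signs of the products with `X`, so its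
  -- orthogonality to `X` annihilates the product at `e`.
  have h0 : C e * X e = 0 := by
    have k : ∀ f, C f * X f = 0 ∨ C f * X f = V f * X f := fun f => by
      rcases hCV f with h | h <;> simp [h]
    rcases hsign with hs | hs
    · refine hCX.eq_zero_of_nonneg (fun f => ?_) e
      rcases k f with h | h
      · exact h.ge
      · rw [h]
        exact hs f
    · have := hCX.neg_left.eq_zero_of_nonneg (fun f => by
        rcases k f with h | h
        · simp [h]
        · have := hs f
          simpa [h] using this) e
      simpa using this
  rw [hCe] at h0
  exact he h0

/-- The elements sharing no circuit with `p` form a set `T` that contains every circuit it meets.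
Cutting a positive full-support covector down to `T` therefore preserves orthogonality to all
circuits. If `T` is nonempty, the result is a covector containing a positive cocircuit that avoids
`p`. -/
theorem Bounded.connected {M : OrientedMatroid α} {p : α} (h : M.Bounded p) : M.Connected := by
  classical
  obtain ⟨hpE, hac, hp⟩ := h
  obtain ⟨X, hX, hXn, hXE⟩ := M.acyclic_iff.1 hac
  have key : ∀ e ∈ M.E, e ≠ p → ∃ C, M.IsCircuit C ∧ C e ≠ 0 ∧ C p ≠ 0 := by
    by_contra! hcon
    obtain ⟨e, heE, hep, he⟩ := hcon
    let T : Set α := {f | f ≠ p ∧ ∀ C, M.IsCircuit C → C f ≠ 0 → C p = 0}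
    have hT : ∀ C, M.IsCircuit C → ∀ f ∈ T, C f ≠ 0 → ∀ g, C g ≠ 0 → g ∈ T := by
      intro C hC f hf hCf g hCg
      refine ⟨?_, fun D hD hDg => ?_⟩
      · rintro rfl
        exact hCg (hf.2 C hC hCf)
      · by_contra hDp
        obtain ⟨Z, hZ, hZf, hZp⟩ := M.dual.exists_common_cocircuit hC hD hCf hCg hDg hDp
        exact hZp (hf.2 Z hZ hZf)
    have hY : T.indicator X ∈ M.covectors := by
      refine M.mem_covectors_of_orthogonal_circuits (fun f hf => ?_) fun C hC => ?_
      · exact M.support_subset X hX (Set.indicator_apply_ne_zero.1 hf).2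
      · by_cases hm : ∃ f ∈ T, C f ≠ 0
        · obtain ⟨f, hf, hCf⟩ := hm
          have : ∀ g, C g * T.indicator X g = C g * X g := fun g => by
            by_cases hg : C g = 0
            · simp [hg]
            · rw [Set.indicator_of_mem (hT C hC f hf hCf g hg)]
          simpa only [Orthogonal, this] using hC.1.2 X hX
        · push Not at hm
          refine Or.inl fun g => ?_
          by_cases hg : g ∈ T
          · simp [hm g hg]
          · simp [hg]
    obtain ⟨D, hD, -, hDT⟩ := M.exists_isPosCocircuit hY
      (fun f => Set.indicator_apply_nonneg fun _ => hXn f) (e := e)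
      (by rw [Set.indicator_of_mem (show e ∈ T from ⟨hep, he⟩)]; exact hXE e heE)
    exact (Set.indicator_apply_ne_zero.1 (hDT (hp D hD))).1.1 rfl
  intro e he f hf hef
  by_cases hep : e = p
  · subst hep
    obtain ⟨C, hC, h₁, h₂⟩ := key f hf (Ne.symm hef)
    exact ⟨C, hC, h₂, h₁⟩
  by_cases hfp : f = p
  · subst hfp
    exact key e he hef
  obtain ⟨C, hC, heC, hpC⟩ := key e he hep
  obtain ⟨D, hD, hfD, hpD⟩ := key f hf hfp
  exact M.dual.exists_common_cocircuit hC hD heC hpC hpD hfD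

theorem Acyclic.not_isLoop {M : OrientedMatroid α} (h : M.Acyclic) : ¬ M.IsLoop := by
  rintro ⟨e, hE, C, hC, hs⟩
  obtain ⟨X, hX, hXn, hXE⟩ := M.acyclic_iff.1 h
  have he : X e ≠ 0 := hXE e (by simp [hE])
  have hCe : C e ≠ 0 := by
    rw [← Function.mem_support, hs]
    rfl
  have h0 : ∀ f, f ≠ e → C f * X f = 0 := fun f hf => by
    have : C f = 0 := by
      by_contra h
      exact hf (by simpa [hs] using Function.mem_support.2 h)
    simp [this]
  rcases hC.1.2 X hX with h | ⟨⟨f, hf⟩, g, hg⟩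
  · exact mul_ne_zero hCe he (h e)
  · obtain rfl : f = e := by
      by_contra hne
      simp [h0 f hne] at hf
    obtain rfl : g = f := by
      by_contra hne
      simp [h0 g hne] at hg
    rw [hf] at hg
    exact absurd hg (by decide)

theorem isLoop_dual {M : OrientedMatroid α} : M.dual.IsLoop ↔ M.IsIsthmus := by
  simp only [IsLoop, IsIsthmus, IsCircuit, IsCocircuit, vectors_dual]
  exact Iff.rfl

/-- Applying `connected_dual` to the dual avoids any appeal to self-duality of connectedness. -/
theorem DualBounded.connected {M : OrientedMatroid α} {p : α} (h : M.DualBounded p) :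
    M.Connected := by
  rw [dualBounded_iff] at h
  simpa using h.connected_dual

theorem DualBounded.not_isIsthmus {M : OrientedMatroid α} {p : α} (h : M.DualBounded p) :
    ¬ M.IsIsthmus := by
  rw [dualBounded_iff] at h
  rw [← isLoop_dual]
  exact h.2.1.not_isLoop

/-! ### Tools for chains of minors -/

theorem minor_covector_of_mem (M : OrientedMatroid α) {F G : Set α} {X : α → SignType}
    (hX : X ∈ M.covectors) (h0 : ∀ e ∈ F, X e = 0) :
    G.indicator X ∈ ((M.restrict G).contract F).covectors :=
  ⟨⟨X, hX, rfl⟩, fun e he => by simp [Set.indicator, h0 e he]⟩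

/-- This yields F_c = F_0 in the active filtration. -/
theorem sUnion_posCircuit (M : OrientedMatroid α) :
    ⋃₀ {C | M.IsPosCircuit C} = M.E \ ⋃₀ {D | M.IsPosCocircuit D} := by
  ext e
  constructor
  · rintro ⟨C, hC, heC⟩
    refine ⟨IsPosCocircuit.subset_ground (M := M.dual) hC heC, ?_⟩
    rintro ⟨D, hD, heD⟩
    exact Set.disjoint_left.1 (M.disjoint_posCircuit_posCocircuit hC hD) heC heD
  · rintro ⟨heE, he⟩
    rcases M.exists_posCircuit_or_posCocircuit heE with ⟨C, hC, heC⟩ | ⟨D, hD, heD⟩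
    · exact ⟨C, hC, heC⟩
    · exact absurd ⟨D, hD, heD⟩ he

end OrientedMatroid

/-- Locates a step of a chain at which an element enters it, or at which a set begins to meet it. -/
theorem Fin.exists_not_castSucc_and_succ {n : ℕ} {P : Fin (n + 1) → Prop} (h0 : ¬ P 0)
    (hlast : P (Fin.last n)) : ∃ j : Fin n, ¬ P j.castSucc ∧ P j.succ := by
  by_contra! h
  exact Fin.induction (motive := fun k => ¬ P k) h0 h (Fin.last n) hlast

/-! ### The upper half of the active filtration has bounded minors -/

namespace OrientedMatroid

open SignVec

variable {α : Type*} [LinearOrder α]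

/-- The half `∅ ⊆ F_0 ⊂ ⋯ ⊂ F_n = E` of a filtration whose minors `M(F_k)/F_{k-1}` are bounded with
respect to the increasing smallest elements `a_k`. -/
structure IsBoundedChain (M : OrientedMatroid α) {n : ℕ} (F : Fin (n + 1) → Set α)
    (a : Fin n → α) : Prop where
  strictMono : StrictMono F
  top : F (Fin.last n) = M.E
  strictMono_min : StrictMono a
  isLeast : ∀ k, IsLeast (F k.succ \ F k.castSucc) (a k)
  bounded : ∀ k, ((M.restrict (F k.succ)).contract (F k.castSucc)).Bounded (a k)

/-- The enumeration of the dual-active elements. -/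
noncomputable def dualActiveEmb (M : OrientedMatroid α) :
    Fin M.dualActive_finite.toFinset.card ↪o α :=
  M.dualActive_finite.toFinset.orderEmbOfFin rfl

/-- The sets `F_0, …, F_ι` of the active filtration. -/
noncomputable def activeChain (M : OrientedMatroid α) :
    Fin (M.dualActive_finite.toFinset.card + 1) → Set α :=
  Fin.snoc (α := fun _ => Set α)
    (fun k => M.E \ ⋃₀ {D | M.IsPosCocircuit D ∧ ∃ m, IsLeast D m ∧ M.dualActiveEmb k ≤ m}) M.E

theorem IsPosCocircuit.exists_isLeast {M : OrientedMatroid α} {D : Set α}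
    (hD : M.IsPosCocircuit D) : ∃ m, IsLeast D m := by
  obtain ⟨m, hm, hmin⟩ := Set.exists_min_image D id (M.finite_ground.subset hD.subset_ground)
    hD.nonempty
  exact ⟨m, hm, hmin⟩

theorem range_dualActiveEmb (M : OrientedMatroid α) : Set.range M.dualActiveEmb = M.dualActive := by
  rw [dualActiveEmb, Finset.range_orderEmbOfFin, Set.Finite.coe_toFinset]

theorem IsPosCocircuit.exists_isLeast_dualActiveEmb {M : OrientedMatroid α} {D : Set α}
    (hD : M.IsPosCocircuit D) : ∃ l, IsLeast D (M.dualActiveEmb l) := by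
  obtain ⟨m, hm⟩ := hD.exists_isLeast
  have : m ∈ Set.range M.dualActiveEmb := by
    rw [range_dualActiveEmb]
    exact ⟨D, hD, hm⟩
  obtain ⟨l, rfl⟩ := this
  exact ⟨l, hm⟩

theorem exists_posCocircuit_isLeast_dualActiveEmb (M : OrientedMatroid α)
    (l : Fin M.dualActive_finite.toFinset.card) :
    ∃ D, M.IsPosCocircuit D ∧ IsLeast D (M.dualActiveEmb l) := by
  exact M.range_dualActiveEmb.subset ⟨l, rfl⟩

/-- Comparing indices instead of elements treats all `k` uniformly: for the last index the condition
is vacuous, as no `l.castSucc` reaches it. -/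
theorem mem_activeChain (M : OrientedMatroid α) {e : α}
    {k : Fin (M.dualActive_finite.toFinset.card + 1)} :
    e ∈ M.activeChain k ↔ e ∈ M.E ∧ ∀ D l, M.IsPosCocircuit D → IsLeast D (M.dualActiveEmb l) →
      k ≤ l.castSucc → e ∉ D := by
  cases k using Fin.lastCases with
  | last =>
    rw [activeChain, Fin.snoc_last]
    exact ⟨fun h => ⟨h, fun D l _ _ hl => absurd hl (not_le.2 (Fin.castSucc_lt_last l))⟩,
      fun h => h.1⟩
  | cast k =>
    rw [activeChain, Fin.snoc_castSucc]
    refine and_congr_right fun _ => ⟨fun h D l hD hl hkl heD => h ⟨D, ⟨hD, _, hl, ?_⟩, heD⟩, ?_⟩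
    · exact M.dualActiveEmb.le_iff_le.2 (by simpa using hkl)
    · rintro h ⟨D, ⟨hD, m, hm, hkm⟩, heD⟩
      obtain ⟨l, hl⟩ := hD.exists_isLeast_dualActiveEmb
      refine h D l hD hl ?_ heD
      rw [hm.unique hl, OrderEmbedding.le_iff_le] at hkm
      simpa using hkm

theorem activeChain_zero (M : OrientedMatroid α) :
    M.activeChain 0 = M.E \ ⋃₀ {D | M.IsPosCocircuit D} := by
  ext e
  rw [mem_activeChain]
  refine and_congr_right fun _ => ⟨?_, fun h D l hD _ _ heD => h ⟨D, hD, heD⟩⟩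
  rintro h ⟨D, hD, heD⟩
  obtain ⟨l, hl⟩ := IsPosCocircuit.exists_isLeast_dualActiveEmb hD
  exact h D l hD hl (Fin.zero_le _) heD

theorem exists_covector_support_eq_compl_activeChain (M : OrientedMatroid α)
    (k : Fin (M.dualActive_finite.toFinset.card + 1)) :
    ∃ X ∈ M.covectors, (∀ f, 0 ≤ X f) ∧ Function.support X = M.E \ M.activeChain k := by
  refine M.exists_covector_support_eq fun e he => ?_
  rw [Set.mem_sdiff, mem_activeChain, not_and] at he
  have := he.2 he.1
  push Not at this
  obtain ⟨D, l, hD, hl, hkl, heD⟩ := this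
  refine ⟨D, hD, heD, fun f hf => ⟨hD.subset_ground hf, fun hf' => ?_⟩⟩
  exact (M.mem_activeChain.1 hf').2 D l hD hl hkl hf

theorem isLeast_activeChain (M : OrientedMatroid α) (k : Fin M.dualActive_finite.toFinset.card) :
    IsLeast (M.activeChain k.succ \ M.activeChain k.castSucc) (M.dualActiveEmb k) := by
  obtain ⟨D, hD, hk⟩ := M.exists_posCocircuit_isLeast_dualActiveEmb k
  refine ⟨⟨M.mem_activeChain.2 ⟨hD.subset_ground hk.1, fun D' l _ hl hkl hmem => ?_⟩, fun h =>
    (M.mem_activeChain.1 h).2 D k hD hk le_rfl hk.1⟩, fun x hx => ?_⟩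
  · have h1 : k < l := Fin.succ_le_castSucc_iff.1 hkl
    exact absurd (hl.2 hmem) (not_le.2 (M.dualActiveEmb.lt_iff_lt.2 h1))
  · have hxE := (M.mem_activeChain.1 hx.1).1
    have := mt M.mem_activeChain.2 hx.2
    push Not at this
    obtain ⟨D', l, -, hl, hkl, hxD⟩ := this hxE
    exact (M.dualActiveEmb.le_iff_le.2 (by simpa using hkl)).trans (hl.2 hxD)

theorem monotone_activeChain (M : OrientedMatroid α) : Monotone M.activeChain := fun _ _ hij _ he =>
  M.mem_activeChain.2 ⟨(M.mem_activeChain.1 he).1, fun D l hD hl hjl =>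
    (M.mem_activeChain.1 he).2 D l hD hl (hij.trans hjl)⟩

theorem isBoundedChain_activeChain (M : OrientedMatroid α) :
    M.IsBoundedChain M.activeChain M.dualActiveEmb where
  strictMono := Fin.strictMono_iff_lt_succ.2 fun k =>
    ⟨M.monotone_activeChain (Fin.castSucc_lt_succ).le, fun h =>
      (M.isLeast_activeChain k).1.2 (h (M.isLeast_activeChain k).1.1)⟩
  top := by rw [activeChain, Fin.snoc_last]
  strictMono_min := M.dualActiveEmb.strictMono
  isLeast := M.isLeast_activeChain
  bounded := fun k => by
    have hk := M.isLeast_activeChain k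
    refine ⟨⟨⟨(M.mem_activeChain.1 hk.1.1).1, hk.1.1⟩, hk.1.2⟩, ?_, ?_⟩
    · rw [acyclic_iff]
      obtain ⟨X, hX, hXn, hXs⟩ := M.exists_covector_support_eq_compl_activeChain k.castSucc
      refine ⟨_, M.minor_covector_of_mem (G := M.activeChain k.succ) hX (fun e he => ?_),
        fun f => Set.indicator_apply_nonneg fun _ => hXn f, ?_⟩
      · by_contra h
        exact (hXs.subset h).2 he
      · rintro e ⟨⟨heE, heS⟩, heC⟩
        rw [Set.indicator_of_mem heS]
        exact hXs.symm.subset ⟨heE, heC⟩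
    · rintro _ ⟨_, ⟨⟨⟨X, hX, rfl⟩, hX0⟩, hne, -⟩, hXn, rfl⟩
      -- `X` is controlled only on F_{k+1}. Composing after `T`, which is positive exactly off that
      -- set, masks its other signs and gives a nonnegative covector of `M`.
      obtain ⟨T, hT, hTn, hTs⟩ := M.exists_covector_support_eq_compl_activeChain k.succ
      obtain ⟨f, hf⟩ := Function.ne_iff.1 hne
      obtain ⟨hfS, hXf⟩ := Set.indicator_apply_ne_zero.1 hf
      have hT0 : ∀ g ∈ M.activeChain k.succ, T g = 0 := fun g hg => by
        by_contra h
        exact (hTs.subset h).2 hg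
      have hcomp : ∀ g ∈ M.activeChain k.succ, comp T X g =
          (M.activeChain k.succ).indicator X g := fun g hg => by
        rw [comp_apply_eq_right (hT0 g hg), Set.indicator_of_mem hg]
      have hcn : ∀ g, 0 ≤ comp T X g := fun g => by
        by_cases hg : g ∈ M.activeChain k.succ
        · rw [hcomp g hg]
          exact hXn g
        · by_cases hgE : g ∈ M.E
          · rw [comp_apply_eq_left (hTs.symm.subset ⟨hgE, hg⟩)]
            exact hTn g
          · exact (M.covector_eq_zero (M.comp_mem T hT X hX) hgE).ge
      obtain ⟨D, hD, hfD, hDs⟩ := M.exists_isPosCocircuit (M.comp_mem T hT X hX) hcn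
        (e := f) (by rw [hcomp f hfS]; exact hf)
      obtain ⟨l, hl⟩ := hD.exists_isLeast_dualActiveEmb
      -- The smallest element of `D` is pinned from both sides: `D` meets F_{k+1} at `f`, so l ≤ k;
      -- and `D` avoids F_k, which contains the dual-active elements of index below `k`, so k ≤ l.
      have hlk : l ≤ k := by
        by_contra h
        exact (M.mem_activeChain.1 hfS).2 D l hD hl
          (Fin.succ_le_castSucc_iff.2 (not_le.1 h)) hfD
      have hkl : k ≤ l := by
        by_contra h
        have hlS : M.dualActiveEmb l ∈ M.activeChain k.castSucc :=
          M.monotone_activeChain (Fin.succ_le_castSucc_iff.2 (not_le.1 h))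
            (M.isLeast_activeChain l).1.1
        have hlS' := M.monotone_activeChain (Fin.castSucc_lt_succ).le hlS
        refine hDs hl.1 ?_
        rw [hcomp _ hlS']
        exact hX0 _ hlS
      obtain rfl := le_antisymm hlk hkl
      have := hDs hl.1
      rwa [Function.mem_support, hcomp _ hk.1.1] at this

/-! ### Uniqueness of chains with bounded minors -/

namespace IsBoundedChain

variable {M : OrientedMatroid α} {n : ℕ} {F : Fin (n + 1) → Set α} {a : Fin n → α}

theorem subset_ground (h : M.IsBoundedChain F a) (k : Fin (n + 1)) : F k ⊆ M.E :=
  h.top ▸ h.strictMono.monotone (Fin.le_last k)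

/-- Descend from the top: compose the covector already built off F_{k+1} with a lift of the positive
full-support covector of the acyclic minor on F_{k+1} \ F_k. -/
theorem exists_covector_support_eq (h : M.IsBoundedChain F a) (k : Fin (n + 1)) :
    ∃ X ∈ M.covectors, (∀ f, 0 ≤ X f) ∧ Function.support X = M.E \ F k := by
  induction k using Fin.reverseInduction with
  | last => exact ⟨0, M.zero_mem, fun _ => le_rfl, by simp [h.top]⟩
  | cast k ih =>
    obtain ⟨T, hT, hTn, hTs⟩ := ih
    obtain ⟨_, ⟨⟨X, hX, rfl⟩, hX0⟩, hXn, hXE⟩ := (acyclic_iff _).1 (h.bounded k).2.1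
    have hsub : F k.castSucc ⊆ F k.succ := h.strictMono.monotone (Fin.castSucc_lt_succ).le
    have hcomp : ∀ g ∈ F k.succ, comp T X g = (F k.succ).indicator X g := fun g hg => by
      rw [comp_apply_eq_right, Set.indicator_of_mem hg]
      by_contra h
      exact (hTs.subset h).2 hg
    have hcT : ∀ g ∈ M.E, g ∉ F k.succ → T g ≠ 0 ∧ comp T X g = T g := fun g hgE hg => by
      have : T g ≠ 0 := hTs.symm.subset ⟨hgE, hg⟩
      exact ⟨this, comp_apply_eq_left this⟩
    have hc := M.comp_mem T hT X hX
    refine ⟨comp T X, hc, fun g => ?_, ?_⟩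
    · by_cases hgE : g ∈ M.E
      · by_cases hg : g ∈ F k.succ
        · rw [hcomp g hg]
          exact hXn g
        · rw [(hcT g hgE hg).2]
          exact hTn g
      · exact (M.covector_eq_zero hc hgE).ge
    · ext g
      by_cases hgE : g ∈ M.E
      · by_cases hg : g ∈ F k.succ
        · rw [Function.mem_support, hcomp g hg]
          exact ⟨fun h' => ⟨hgE, fun h'' => h' (hX0 g h'')⟩, fun h' => hXE g ⟨⟨hgE, hg⟩, h'.2⟩⟩
        · rw [Function.mem_support, (hcT g hgE hg).2]
          exact ⟨fun _ => ⟨hgE, fun h' => hg (hsub h')⟩, fun _ => (hcT g hgE hg).1⟩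
      · exact ⟨fun h' => absurd (M.support_subset _ hc h') hgE, fun h' => absurd h'.1 hgE⟩

theorem exists_posCocircuit (h : M.IsBoundedChain F a) {k : Fin (n + 1)} {e : α} (heE : e ∈ M.E)
    (he : e ∉ F k) : ∃ D, M.IsPosCocircuit D ∧ e ∈ D ∧ Disjoint D (F k) := by
  obtain ⟨X, hX, hXn, hXs⟩ := h.exists_covector_support_eq k
  obtain ⟨D, hD, heD, hDX⟩ := M.exists_isPosCocircuit hX hXn (hXs.symm.subset ⟨heE, he⟩)
  exact ⟨D, hD, heD, Set.disjoint_left.2 fun f hf => (hXs.subset (hDX hf)).2⟩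

/-- The element enters the chain at some step `i ≥ j`, so it is at least `a i`, and the minima
increase. -/
theorem le_of_notMem (h : M.IsBoundedChain F a) {j : Fin n} {x : α} (hxE : x ∈ M.E)
    (hx : x ∉ F j.castSucc) : a j ≤ x := by
  obtain ⟨i, hi, hi'⟩ := Fin.exists_not_castSucc_and_succ (P := fun k => x ∈ F k)
    (fun h0 => hx (h.strictMono.monotone (Fin.zero_le _) h0)) (by rwa [h.top])
  have hji : j ≤ i := by
    by_contra hlt
    exact hx (h.strictMono.monotone (Fin.succ_le_castSucc_iff.2 (not_le.1 hlt)) hi')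
  exact (h.strictMono_min.monotone hji).trans ((h.isLeast i).2 ⟨hi', hi⟩)

/-- At a step where `D` begins to meet the chain, its trace is a nonzero nonnegative covector of the
minor, so it contains a positive cocircuit of the minor and, by boundedness, `a j`. Everything in
`D` lies off F_j, so `a j` is its minimum. -/
theorem exists_isLeast (h : M.IsBoundedChain F a) {D : Set α} (hD : M.IsPosCocircuit D)
    (h0 : Disjoint D (F 0)) : ∃ j, IsLeast D (a j) ∧ Disjoint D (F j.castSucc) := by
  obtain ⟨j, hj, hj'⟩ := Fin.exists_not_castSucc_and_succ (P := fun k => ¬ Disjoint D (F k))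
    (not_not.2 h0) (by
      rw [h.top]
      obtain ⟨e, he⟩ := hD.nonempty
      exact Set.not_disjoint_iff.2 ⟨e, he, hD.subset_ground he⟩)
  rw [not_not] at hj
  refine ⟨j, ⟨?_, fun x hx => h.le_of_notMem (hD.subset_ground hx) (Set.disjoint_left.1 hj hx)⟩,
    hj⟩
  obtain ⟨e, he, heF⟩ := Set.not_disjoint_iff.1 hj'
  obtain ⟨X, hX, hXn, rfl⟩ := hD
  obtain ⟨D', hD', -, hDX⟩ := exists_isPosCocircuit _
    (M.minor_covector_of_mem (F := F j.castSucc) (G := F j.succ) hX.1 (fun f hf => by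
      by_contra h'
      exact Set.disjoint_left.1 hj h' hf))
    (fun f => Set.indicator_apply_nonneg fun _ => hXn f) (e := e)
    (by rwa [Set.indicator_of_mem heF])
  exact (Set.indicator_apply_ne_zero.1 (hDX ((h.bounded j).2.2 D' hD'))).2

/-- The minima are exactly the dual-active elements, which fixes `n` and `a`. An element is then off
F_k exactly when it lies in a positive cocircuit with minimum `a l`, `l ≥ k`. The dependent pair
accounts for the length not being prescribed. -/
theorem eq_activeChain (h : M.IsBoundedChain F a) (h0 : ∀ D, M.IsPosCocircuit D → Disjoint D (F 0)) :
    (⟨n, F⟩ : (n : ℕ) × (Fin (n + 1) → Set α)) = ⟨_, M.activeChain⟩ := by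
  have hrange : Set.range a = M.dualActive := by
    ext x
    constructor
    · rintro ⟨k, rfl⟩
      have hk := (h.isLeast k).1
      obtain ⟨D, hD, hkD, hDF⟩ := h.exists_posCocircuit (h.subset_ground _ hk.1) hk.2
      exact ⟨D, hD, hkD, fun y hy =>
        h.le_of_notMem (hD.subset_ground hy) (Set.disjoint_left.1 hDF hy)⟩
    · rintro ⟨D, hD, hx⟩
      obtain ⟨j, hj, -⟩ := h.exists_isLeast hD (h0 D hD)
      exact ⟨j, hj.unique hx⟩
  have hn : n = M.dualActive_finite.toFinset.card := by
    rw [← Set.ncard_eq_toFinset_card _ M.dualActive_finite, ← hrange, ← Set.image_univ,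
      Set.ncard_image_of_injective _ h.strictMono_min.injective, Set.ncard_univ, Nat.card_fin]
  subst hn
  have ha : a = M.dualActiveEmb := Finset.orderEmbOfFin_unique rfl (fun k => by
    rw [Set.Finite.mem_toFinset, ← hrange]
    exact ⟨k, rfl⟩) h.strictMono_min
  congr 1
  funext k
  ext e
  rw [mem_activeChain, ← ha]
  refine ⟨fun he => ⟨h.subset_ground k he, fun D l hD hl hkl heD => ?_⟩, fun he => ?_⟩
  · obtain ⟨j, hj, hjD⟩ := h.exists_isLeast hD (h0 D hD)
    obtain rfl := h.strictMono_min.injective (hj.unique hl)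
    exact Set.disjoint_left.1 hjD heD (h.strictMono.monotone hkl he)
  · by_contra hek
    obtain ⟨D, hD, heD, hDF⟩ := h.exists_posCocircuit he.1 hek
    obtain ⟨j, hj, hjD⟩ := h.exists_isLeast hD (h0 D hD)
    refine he.2 D j hD hj ?_ heD
    by_contra hlt
    exact Set.disjoint_left.1 hDF hj.1
      (h.strictMono.monotone (Fin.castSucc_lt_iff_succ_le.1 (not_le.1 hlt)) (h.isLeast j).1.1)

end IsBoundedChain

end OrientedMatroid

/-! ### The lower half by duality, and the full filtration -/

namespace OrientedMatroid

variable {α : Type*} [LinearOrder α]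

theorem activeFiltration_F' (M : OrientedMatroid α) (k : Fin (M.activeFiltration.ε + 1)) :
    M.activeFiltration.F' k = M.E \ M.dual.activeChain k := by
  have hsub : ∀ p : Set α → Prop, ⋃₀ {C | M.IsPosCircuit C ∧ p C} ⊆ M.E := fun p =>
    Set.sUnion_subset fun C hC => IsPosCocircuit.subset_ground (M := M.dual) hC.1
  change Fin M.active_finite.toFinset.card.succ at k
  -- Active elements and positive circuits of `M` are by definition dual-active elements and
  -- positive cocircuits of `M.dual`, so both sides use the same enumeration and the same unions.
  change (Fin.snoc (α := fun _ => Set α) (fun k : Fin M.active_finite.toFinset.card =>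
      ⋃₀ {C | M.IsPosCircuit C ∧ ∃ m, IsLeast C m ∧ M.dual.dualActiveEmb k ≤ m}) ∅ k : Set α) =
    M.E \ Fin.snoc (α := fun _ => Set α) (fun k : Fin M.active_finite.toFinset.card =>
      M.E \ ⋃₀ {C | M.IsPosCircuit C ∧ ∃ m, IsLeast C m ∧ M.dual.dualActiveEmb k ≤ m}) M.E k
  cases k using Fin.lastCases with
  | last => simp only [Fin.snoc_last, Set.sdiff_self]
  | cast k => simp only [Fin.snoc_castSucc, Set.sdiff_sdiff_cancel_left (hsub _)]

/-- A decreasing chain ending at `∅` with dual-bounded minors is complementary to a chain of the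
dual with bounded minors. -/
theorem isBoundedChain_dual_iff (M : OrientedMatroid α) {n : ℕ} {F : Fin (n + 1) → Set α}
    {a : Fin n → α} (hF : ∀ k, F k ⊆ M.E) :
    M.dual.IsBoundedChain (fun k => M.E \ F k) a ↔
      StrictAnti F ∧ F (Fin.last n) = ∅ ∧ StrictMono a ∧
        (∀ k, IsLeast (F k.castSucc \ F k.succ) (a k)) ∧
        ∀ k, ((M.restrict (F k.castSucc)).contract (F k.succ)).DualBounded (a k) := by
  have hdiff : ∀ k : Fin n, (M.E \ F k.succ) \ (M.E \ F k.castSucc) = F k.castSucc \ F k.succ := by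
    intro k
    ext e
    have := @hF k.castSucc e
    simp only [Set.mem_sdiff]
    tauto
  have hanti : StrictMono (fun k => M.E \ F k) ↔ StrictAnti F := by
    have hle : ∀ i j, M.E \ F i ⊆ M.E \ F j ↔ F j ⊆ F i := fun i j => by
      refine ⟨fun h e he => ?_, Set.sdiff_subset_sdiff_right⟩
      by_contra h'
      exact (h ⟨hF j he, h'⟩).2 he
    have hlt : ∀ i j, M.E \ F i ⊂ M.E \ F j ↔ F j ⊂ F i := fun i j => by
      simp only [ssubset_iff_subset_not_subset, hle]
    exact ⟨fun h i j hij => (hlt i j).1 (h hij), fun h i j hij => (hlt i j).2 (h hij)⟩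
  have htop : M.E \ F (Fin.last n) = M.E ↔ F (Fin.last n) = ∅ := by
    rw [sdiff_eq_left]
    refine ⟨fun h => ?_, fun h => h ▸ disjoint_bot_right⟩
    exact Set.eq_empty_of_forall_notMem fun e he => Set.disjoint_left.1 h (hF _ he) he
  have hbd : StrictAnti F → ∀ k : Fin n, ∀ p,
      ((M.restrict (F k.castSucc)).contract (F k.succ)).DualBounded p ↔
      ((M.dual.restrict (M.E \ F k.succ)).contract (M.E \ F k.castSucc)).Bounded p := by
    intro h k p
    rw [dualBounded_iff, dual_minor _ (h.antitone (Fin.castSucc_lt_succ).le)]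
  constructor
  · rintro ⟨h₁, h₂, h₃, h₄, h₅⟩
    have h₁' := hanti.1 h₁
    exact ⟨h₁', htop.1 h₂, h₃, fun k => hdiff k ▸ h₄ k, fun k => (hbd h₁' k _).2 (h₅ k)⟩
  · rintro ⟨h₁, h₂, h₃, h₄, h₅⟩
    exact ⟨hanti.2 h₁, htop.2 h₂, h₃, fun k => (hdiff k).symm ▸ h₄ k,
      fun k => (hbd h₁ k _).1 (h₅ k)⟩

theorem activeFiltration_F'_spec (M : OrientedMatroid α) :
    ∃ a' : Fin M.activeFiltration.ε → α, StrictAnti M.activeFiltration.F' ∧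
      M.activeFiltration.F' (Fin.last _) = ∅ ∧ StrictMono a' ∧
      (∀ k, IsLeast (M.activeFiltration.F' k.castSucc \ M.activeFiltration.F' k.succ) (a' k)) ∧
      ∀ k, ((M.restrict (M.activeFiltration.F' k.castSucc)).contract
        (M.activeFiltration.F' k.succ)).DualBounded (a' k) := by
  refine ⟨M.dual.dualActiveEmb, (M.isBoundedChain_dual_iff (F := M.activeFiltration.F')
    fun k => ?_).1 ?_⟩
  · rw [activeFiltration_F']
    exact Set.sdiff_subset
  · have : (fun k => M.E \ M.activeFiltration.F' k) = M.dual.activeChain := by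
      funext k
      rw [activeFiltration_F', Set.sdiff_sdiff_cancel_left]
      exact M.dual.isBoundedChain_activeChain.subset_ground k
    rw [this]
    exact M.dual.isBoundedChain_activeChain

theorem hasBoundedMinors_activeFiltration (M : OrientedMatroid α) :
    M.HasBoundedMinors M.activeFiltration where
  bounded := fun k =>
    ⟨_, M.isBoundedChain_activeChain.isLeast k, M.isBoundedChain_activeChain.bounded k⟩
  dualBounded := fun k => by
    obtain ⟨a', -, -, -, h₁, h₂⟩ := M.activeFiltration_F'_spec
    exact ⟨a' k, h₁ k, h₂ k⟩

theorem isFiltration_activeFiltration (M : OrientedMatroid α) :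
    M.activeFiltration.IsFiltration M.E := by
  obtain ⟨a', h₁, h₂, h₃, h₄, -⟩ := M.activeFiltration_F'_spec
  have h := M.isBoundedChain_activeChain
  refine ⟨h₂, h₁, ?_, ?_, h.strictMono, h.top, ⟨_, h.strictMono_min, h.isLeast⟩, a', h₃, h₄⟩
  · rw [activeFiltration_F']
    refine (congrArg (M.E \ ·) M.dual.activeChain_zero).trans ?_
    exact Set.sdiff_sdiff_cancel_left
      (Set.sUnion_subset fun C hC => IsPosCocircuit.subset_ground (M := M.dual) hC)
  · exact M.activeChain_zero.trans M.sUnion_posCircuit.symm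

theorem HasBoundedMinors.isConnectedFiltration {M : OrientedMatroid α} {S : FiltrationSeq α}
    (h : M.HasBoundedMinors S) (hS : S.IsFiltration M.E) : M.IsConnectedFiltration S where
  isFiltration := hS
  connected_F := fun k => by
    obtain ⟨a, -, ha⟩ := h.bounded k
    exact ⟨ha.connected, ha.2.1.not_isLoop⟩
  connected_F' := fun k => by
    obtain ⟨a, -, ha⟩ := h.dualBounded k
    exact ⟨ha.connected, ha.not_isIsthmus⟩

/-- The two halves cover the complement of F_c by positive cocircuits and F_c by positive circuits,
so F_c is forced. The same covering gives the disjointness from the initial set that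
`eq_activeChain` requires, for `M` and for its dual. -/
theorem HasBoundedMinors.eq_activeFiltration {M : OrientedMatroid α} {S : FiltrationSeq α}
    (h : M.HasBoundedMinors S) (hS : S.IsFiltration M.E) : S = M.activeFiltration := by
  obtain ⟨a, ha, hmin⟩ := hS.min_F
  obtain ⟨a', ha', hmin'⟩ := hS.min_F'
  have hF : M.IsBoundedChain S.F a := ⟨hS.strictMono, hS.top, ha, hmin, fun k => by
    obtain ⟨b, hb, hbd⟩ := h.bounded k
    rwa [(hmin k).unique hb]⟩
  have hsub : ∀ k, S.F' k ⊆ M.E := fun k =>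
    (hS.strictAnti.antitone (Fin.zero_le k)).trans
      ((hS.F'_zero.trans hS.F_zero.symm).subset.trans (hF.subset_ground 0))
  have hF' : M.dual.IsBoundedChain (fun k => M.E \ S.F' k) a' :=
    (M.isBoundedChain_dual_iff hsub).2 ⟨hS.strictAnti, hS.bot, ha', hmin', fun k => by
      obtain ⟨b, hb, hbd⟩ := h.dualBounded k
      rwa [(hmin' k).unique hb]⟩
  -- the elements outside `F_c` lie in positive cocircuits, those of `F_c` in positive circuits
  have hcirc : ∀ e ∈ S.Fc, ∃ C, M.IsPosCircuit C ∧ e ∈ C := fun e he => by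
    rw [← hS.F'_zero] at he
    obtain ⟨C, hC, heC, -⟩ := hF'.exists_posCocircuit (k := 0) (hsub 0 he) fun h => h.2 he
    exact ⟨C, hC, heC⟩
  have hcocirc : ∀ e ∈ M.E, e ∉ S.Fc → ∃ D, M.IsPosCocircuit D ∧ e ∈ D := fun e heE he => by
    rw [← hS.F_zero] at he
    obtain ⟨D, hD, heD, -⟩ := hF.exists_posCocircuit heE he
    exact ⟨D, hD, heD⟩
  have hdisj : ∀ {C D : Set α} {e}, M.IsPosCircuit C → M.IsPosCocircuit D → e ∈ C → e ∉ D :=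
    fun hC hD => fun h => Set.disjoint_left.1 (M.disjoint_posCircuit_posCocircuit hC hD) h
  have hFc : S.Fc = ⋃₀ {C | M.IsPosCircuit C} := by
    ext e
    refine ⟨fun he => (hcirc e he).imp fun C hC => hC, ?_⟩
    rintro ⟨C, hC, heC⟩
    by_contra he
    obtain ⟨D, hD, heD⟩ :=
      hcocirc e (IsPosCocircuit.subset_ground (M := M.dual) hC heC) he
    exact hdisj hC hD heC heD
  have hup := hF.eq_activeChain fun D hD => Set.disjoint_right.2 fun e he => by
    rw [hS.F_zero] at he
    obtain ⟨C, hC, heC⟩ := hcirc e he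
    exact hdisj hC hD heC
  have hlow := hF'.eq_activeChain fun C hC => Set.disjoint_right.2 fun e he heC => by
    rw [hS.F'_zero] at he
    obtain ⟨D, hD, heD⟩ := hcocirc e he.1 he.2
    exact hdisj hC hD heC heD
  -- The lengths are identified first, so that the families indexed by them can be compared.
  obtain ⟨ι, ε, F, Fc, F'⟩ := S
  simp only at hup hlow hFc hsub
  obtain ⟨rfl, hFeq⟩ := Sigma.mk.inj hup
  obtain ⟨rfl, hFeq'⟩ := Sigma.mk.inj hlow
  obtain rfl := eq_of_heq hFeq
  subst hFc
  have : F' = M.activeFiltration.F' := by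
    funext k
    refine Eq.trans ?_ (M.activeFiltration_F' k).symm
    refine Eq.trans ?_ (congrArg (M.E \ ·) (congrFun (eq_of_heq hFeq') k))
    exact (Set.sdiff_sdiff_cancel_left (hsub k)).symm
  subst this
  rfl

end OrientedMatroid

theorem theorem4p4 {α : Type*} [LinearOrder α] (M : OrientedMatroid α) :
    M.IsConnectedFiltration M.activeFiltration ∧
      M.HasBoundedMinors M.activeFiltration ∧
      ∀ S : FiltrationSeq α, S.IsFiltration M.E → M.HasBoundedMinors S →
        S = M.activeFiltration :=
  ⟨M.hasBoundedMinors_activeFiltration.isConnectedFiltration M.isFiltration_activeFiltration,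
    M.hasBoundedMinors_activeFiltration, fun _ hS h => h.eq_activeFiltration hS⟩
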